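/- **Setting.** There are $n$ bidders and a set $M$ of $m$ items. A valuation is a function $v:2^M\to\mathbb R$ with $v(\emptyset)=0$ that is non-decreasing; it is additive if $v(S)=\sum_{j\in S}v(\{j\})$, and XOS if $v(S)=\max_{r\le t}a_r(S)$ for all $S$, for some additive valuations $a_1,\dots,a_t$. An allocation is a tuple $A=(A_1,\dots,A_n)$ of pairwise disjoint bundles, of welfare $\sum_i v_i(A_i)$. A value query returns $v_i(S)$ for a bundle $S$; a demand query with prices $p\in\mathbb R^M$ returns a bundle $S$ maximizing $v_i(S)-\sum_{j\in S}p_j$ (ties are broken by an arbitrary fixed rule, depending on the bidder, the valuation and the prices). A deterministic mechanism maps valuation profiles to an allocation and payments; it is truthful if for each bidder, whatever the others report, reporting the true valuation maximizes value minus payment. A randomized mechanism is universally truthful if it is a probability distribution over truthful deterministic mechanisms. A fixed price auction with item prices $p$ lets bidders arrive in a given order; each takes a bundle of maximal profit among the remaining items and pays its price. **The mechanism.** Let $\alpha=\max(1,\lceil\sqrt{\log_2 m}\,\rceil)$ and $L=\max(1,\lceil 4\log_2 m/\alpha\rceil)$. 1. With probability $1/2$, sell $M$ by a second price auction among all bidders,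 and stop. 2. Otherwise assign each bidder independently and uniformly to one of the groups STAT, UNIFORM, FINAL. 3. Run the greedy algorithm on the bidders in STAT (go over the items, giving each item to a bidder with the largest marginal value for it). Let $w$ be the welfare of its output, let $\bar w$ be $w$ rounded up to a power of $2$ ($\bar w=0$ if $w=0$), and let $p(k)=2^k\bar w/m^2$ be the price of bin $k$. For $k=1,\dots,\alpha$ let chunk $C_k$ consist of the bins $(k-1)L+1,\dots,kL$. 4. Choose $r\in\{1,\dots,L\}$ and an order $\pi$ of UNIFORM uniformly at random, and put $p_j=0$ for all items $j$. 5. For $k=1,\dots,\alpha$: run a fixed price auction on all items among the bidders of UNIFORM, in the order $\pi$, with the price $p((k-1)L+1)/2$ for every item. With probability $1/\alpha$, stop with the allocation and payments of this auction. Otherwise set $p_j=p((k-1)L+r)/2$ for all items $j$ that were sold in it. 6. If the mechanism has not stopped, run a fixed price auction with prices $p_1,\dots,p_m$ among the bidders in FINAL, and output its result. All random choices are independent of each other. **Theorem.** There are a constant $C>0$ and a polynomial $P$ such that for all $n,m$: * for every outcome of its random coins, the mechanism asks at most $P(n+m)$ value and demand queries; * the mechanism is universally truthful for XOS valuations; *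 if $m\ge 2$, then for all XOS valuations $v_1,\dots,v_n$ the expected welfare $W$ of the mechanism (when bidders report truthfully) satisfies $\mathrm{OPT}\le C\sqrt{\log m}\cdot W$, where $\mathrm{OPT}$ is the maximal welfare of an allocation. Moreover, every submodular valuation ($v(S\cup T)+v(S\cap T)\le v(S)+v(T)$ for all $S,T$) is XOS, so that all of this covers submodular bidders. -/

import Mathlib

namespace CombAuction

/-! ### Valuations, allocations, mechanisms -/

/-- A function assigning a real value to every bundle of the `m` items. -/
abbrev SetValuation (m : ℕ) : Type := Finset (Fin m) → ℝ

/-- A valuation function proper: normalized and non-decreasing. -/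
def IsValuation {m : ℕ} (v : SetValuation m) : Prop :=
  v ∅ = 0 ∧ ∀ S T : Finset (Fin m), S ⊆ T → v S ≤ v T

def IsAdditive {m : ℕ} (v : SetValuation m) : Prop :=
  ∀ S : Finset (Fin m), v S = ∑ j ∈ S, v {j}

/-- XOS: the pointwise maximum of finitely many additive valuations (the clauses). -/
def IsXOS {m : ℕ} (v : SetValuation m) : Prop :=
  ∃ (t : ℕ) (a : Fin t → SetValuation m),
    (∀ r, IsValuation (a r) ∧ IsAdditive (a r)) ∧
      ∀ S : Finset (Fin m), IsGreatest (Set.range fun r => a r S) (v S)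

def IsSubmodular {m : ℕ} (v : SetValuation m) : Prop :=
  ∀ S T : Finset (Fin m), v (S ∪ T) + v (S ∩ T) ≤ v S + v T

/-- One bundle for each of the `n` bidders. -/
abbrev Bundles (n m : ℕ) : Type := Fin n → Finset (Fin m)

/-- No item is given to two bidders (items may stay unallocated). -/
def IsAllocation {n m : ℕ} (A : Bundles n m) : Prop :=
  ∀ i i' : Fin n, i ≠ i' → Disjoint (A i) (A i')

/-- The social welfare. -/
def welfare {n m : ℕ} (v : Fin n → SetValuation m) (A : Bundles n m) : ℝ :=
  ∑ i, v i (A i)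

/-- A bundle and a payment for each bidder. -/
structure Outcome (n m : ℕ) where
  alloc : Bundles n m
  pay : Fin n → ℝ

/-- A deterministic (direct revelation) mechanism. -/
abbrev DetMechanism (n m : ℕ) : Type := (Fin n → SetValuation m) → Outcome n m

/-- On profiles of valuations from `V` the mechanism always outputs an allocation. -/
def DetMechanism.Feasible {n m : ℕ} (V : Set (SetValuation m)) (F : DetMechanism n m) : Prop :=
  ∀ v : Fin n → SetValuation m, (∀ i, v i ∈ V) → IsAllocation (F v).alloc

/-- Reporting the true valuation is a dominant strategy, for valuations from `V`. -/
def DetMechanism.Truthful {n m : ℕ} (V : Set (SetValuation m)) (F : DetMechanism n m) : Prop :=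
  ∀ (i : Fin n) (v : Fin n → SetValuation m), (∀ k, v k ∈ V) → ∀ v' ∈ V,
    v i ((F (Function.update v i v')).alloc i) - (F (Function.update v i v')).pay i
      ≤ v i ((F v).alloc i) - (F v).pay i

/-- A probability distribution over deterministic mechanisms, given by random coins. -/
structure RandomizedMechanism (n m : ℕ) where
  Coins : Type
  [fintypeCoins : Fintype Coins]
  law : PMF Coins
  det : Coins → DetMechanism n m

attribute [instance] RandomizedMechanism.fintypeCoins

/-- Every deterministic mechanism that is drawn with positive probability is a truthful
mechanism on profiles of valuations from `V`. -/
def RandomizedMechanism.UniversallyTruthful {n m : ℕ} (V : Set (SetValuation m))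
    (R : RandomizedMechanism n m) : Prop :=
  ∀ c ∈ R.law.support, (R.det c).Feasible V ∧ (R.det c).Truthful V

noncomputable def RandomizedMechanism.expectedWelfare {n m : ℕ} (R : RandomizedMechanism n m)
    (v : Fin n → SetValuation m) : ℝ :=
  ∑ c, (R.law c).toReal * welfare v (R.det c v).alloc

/-! ### Algorithms with access to the valuations by value and demand queries -/

/-- A deterministic algorithm that adaptively asks queries and finally returns an element of `α`:
`value i S` asks bidder `i` for the value of `S`, and `demand i p` asks bidder `i` for a bundle of
maximal profit at the item prices `p`. -/
inductive QueryAlg (n m : ℕ) (α : Type) : Type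
  | ret : α → QueryAlg n m α
  | value : Fin n → Finset (Fin m) → (ℝ → QueryAlg n m α) → QueryAlg n m α
  | demand : Fin n → (Fin m → ℝ) → (Finset (Fin m) → QueryAlg n m α) → QueryAlg n m α

namespace QueryAlg

variable {n m : ℕ} {α β : Type}

/-- Sequential composition. -/
def bind : QueryAlg n m α → (α → QueryAlg n m β) → QueryAlg n m β
  | ret a, f => f a
  | value i S k, f => value i S fun x => (k x).bind f
  | demand i p k, f => demand i p fun T => (k T).bind f

instance : Monad (QueryAlg n m) where
  pure := ret
  bind := bind

def askValue (i : Fin n) (S : Finset (Fin m)) : QueryAlg n m ℝ := value i S ret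

def askDemand (i : Fin n) (p : Fin m → ℝ) : QueryAlg n m (Finset (Fin m)) := demand i p ret

/-- The result if bidder `i` has valuation `v i` and answers demand queries by `D i`. -/
def run (D : Fin n → SetValuation m → (Fin m → ℝ) → Finset (Fin m)) (v : Fin n → SetValuation m) :
    QueryAlg n m α → α
  | ret a => a
  | value i S k => (k (v i S)).run D v
  | demand i p k => (k (D i (v i) p)).run D v

/-- At most `q` queries are asked, whatever the answers are. -/
def AsksAtMost : QueryAlg n m α → ℕ → Prop
  | ret _, _ => True
  | value _ _ k, q => 0 < q ∧ ∀ x, (k x).AsksAtMost (q - 1)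
  | demand _ _ k, q => 0 < q ∧ ∀ T, (k T).AsksAtMost (q - 1)

end QueryAlg

/-- `D` is a rule for answering demand queries: it selects, for every valuation and all prices,
one of the bundles of maximal profit (so `D` is a way of breaking ties). -/
def IsDemandRule {m : ℕ} (D : SetValuation m → (Fin m → ℝ) → Finset (Fin m)) : Prop :=
  ∀ (v : SetValuation m) (p : Fin m → ℝ) (S : Finset (Fin m)),
    v S - ∑ j ∈ S, p j ≤ v (D v p) - ∑ j ∈ D v p, p j

/-! ### Building blocks of the mechanism -/

section Blocks

variable {n m : ℕ}

/-- Ask each bidder `i` in the list for the value of `S i`. -/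
noncomputable def askValues (S : Bundles n m) : List (Fin n) → QueryAlg n m (Fin n → ℝ)
  | [] => pure fun _ => 0
  | i :: l => do
    let x ← QueryAlg.askValue i (S i)
    let b ← askValues S l
    pure (Function.update b i x)

/-- Second price auction of the grand bundle among all bidders; ties go to the smallest index.
The winner pays the largest bid of the others (zero if there are no others). -/
noncomputable def secondPriceAuction : QueryAlg n m (Outcome n m) := do
  let b ← askValues (fun _ => Finset.univ) (List.finRange n)
  match (List.finRange n).argmax b with
  | none => pure (Outcome.mk (fun _ => ∅) fun _ => 0)
  | some w =>
    pure (Outcome.mk (fun i => if i = w then Finset.univ else ∅)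
      fun i => if i = w then (Finset.univ.erase w).fold max 0 b else 0)

/-- Greedy algorithm: go over the items, and add each to the current bundle of a bidder (among
those in the list `N`) whose marginal value for it is maximal. -/
noncomputable def greedy (N : List (Fin n)) :
    List (Fin m) → Bundles n m → QueryAlg n m (Bundles n m)
  | [], A => pure A
  | j :: items, A => do
    let x ← askValues (fun i => insert j (A i)) N
    let y ← askValues A N
    match N.argmax fun i => x i - y i with
    | none => greedy N items A
    | some i => greedy N items (Function.update A i (insert j (A i)))

/-- Fixed price auction: the bidders arrive in the order of the list, and each takes a most
profitable bundle among the remaining items. An item `j ∉ rest` is excluded from the demand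
query by a price that exceeds the bidder's value for the set of all items. -/
noncomputable def fixedPriceAuction (p : Fin m → ℝ) :
    List (Fin n) → Finset (Fin m) → QueryAlg n m (Bundles n m)
  | [], _ => pure fun _ => ∅
  | i :: l, rest => do
    let x ← QueryAlg.askValue i Finset.univ
    let S ← QueryAlg.askDemand i fun j => if j ∈ rest then p j else x + 1
    let T ← fixedPriceAuction p l (rest \ S)
    pure (Function.update T i S)

/-- Everybody pays the prices `p` of the items in the bundle received. -/
def atPrices (p : Fin m → ℝ) (T : Bundles n m) : Outcome n m :=
  ⟨T, fun i => ∑ j ∈ T i, p j⟩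

end Blocks

/-- `x` rounded up to the nearest power of two (with integer exponent); zero for `x ≤ 0`. -/
noncomputable def roundUp (x : ℝ) : ℝ :=
  if x ≤ 0 then 0 else (2 : ℝ) ^ ⌈Real.logb 2 x⌉

/-- The price associated with bin `k` of an allocation of welfare `w`. -/
noncomputable def binPrice (m : ℕ) (w : ℝ) (k : ℕ) : ℝ :=
  2 ^ k * roundUp w / (m : ℝ) ^ 2

/-- The number `α` of chunks: `√(log m)`, rounded up to a positive integer. -/
noncomputable def numChunks (m : ℕ) : ℕ := max 1 ⌈√(Real.logb 2 m)⌉₊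

/-- The number of bins in a chunk: `4 log m / α`, rounded up to a positive integer. -/
noncomputable def chunkSize (m : ℕ) : ℕ := max 1 ⌈4 * Real.logb 2 m / numChunks m⌉₊

instance (m : ℕ) : NeZero (numChunks m) := ⟨(Nat.lt_of_lt_of_le one_pos (le_max_left _ _)).ne'⟩

instance (m : ℕ) : NeZero (chunkSize m) := ⟨(Nat.lt_of_lt_of_le one_pos (le_max_left _ _)).ne'⟩

/-! ### The mechanism -/

/-- The three groups of bidders. -/
inductive Role
  | stat
  | uniform
  | final
  deriving DecidableEq

instance : Fintype Role :=
  ⟨{Role.stat, Role.uniform, Role.final}, fun r => by cases r <;> simp⟩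

instance : Nonempty Role := ⟨Role.stat⟩

/-- All random coins of the mechanism. They are drawn uniformly, hence independently of each
other. -/
structure MechCoins (n m : ℕ) where
  /-- Sell the grand bundle by a second price auction? -/
  grand : Bool
  /-- The group of each bidder. -/
  role : Fin n → Role
  /-- In each chunk the bin number `bin + 1` is used for pricing. -/
  bin : Fin (chunkSize m)
  /-- A random order on all bidders, which induces a random order on those in `uniform`. -/
  order : Equiv.Perm (Fin n)
  /-- The mechanism ends in chunk `k` if `halt k = 0`, an event of probability `1 / α`. -/
  halt : Fin (numChunks m) → Fin (numChunks m)

section Mechanism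

variable {n m : ℕ}

/-- The coins as a tuple. -/
noncomputable def MechCoins.equivProd : MechCoins n m ≃ Bool × (Fin n → Role) × Fin (chunkSize m) ×
    Equiv.Perm (Fin n) × (Fin (numChunks m) → Fin (numChunks m)) where
  toFun c := (c.grand, c.role, c.bin, c.order, c.halt)
  invFun x := ⟨x.1, x.2.1, x.2.2.1, x.2.2.2.1, x.2.2.2.2⟩
  left_inv _ := rfl
  right_inv _ := rfl

noncomputable instance : Fintype (MechCoins n m) := Fintype.ofEquiv _ MechCoins.equivProd.symm

instance : Nonempty (MechCoins n m) := ⟨⟨true, fun _ => Role.stat, 0, 1, fun _ => 0⟩⟩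

def MechCoins.statBidders (c : MechCoins n m) : List (Fin n) :=
  (List.finRange n).filter fun i => c.role i = Role.stat

/-- The bidders in `uniform`, in their random order. -/
def MechCoins.uniformBidders (c : MechCoins n m) : List (Fin n) :=
  ((List.finRange n).map c.order).filter fun i => c.role i = Role.uniform

def MechCoins.finalBidders (c : MechCoins n m) : List (Fin n) :=
  (List.finRange n).filter fun i => c.role i = Role.final

/-- The loop over the chunks followed by the final fixed price auction. Here `w` is the welfare
of the allocation computed for the bidders in `stat`, and `p` holds the current item prices. The
chunk `k` (counted from zero) consists of the bins `k * chunkSize m + 1`, …,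
`(k + 1) * chunkSize m`. -/
noncomputable def chunkLoop (c : MechCoins n m) (w : ℝ) :
    List (Fin (numChunks m)) → (Fin m → ℝ) → QueryAlg n m (Outcome n m)
  | [], p => do
    let T ← fixedPriceAuction p c.finalBidders Finset.univ
    pure (atPrices p T)
  | k :: ks, p => do
    let low : Fin m → ℝ := fun _ => binPrice m w (k * chunkSize m + 1) / 2
    let T ← fixedPriceAuction low c.uniformBidders Finset.univ
    if c.halt k = 0 then
      pure (atPrices low T)
    else
      chunkLoop c w ks fun j =>
        if j ∈ Finset.univ.biUnion T then binPrice m w (k * chunkSize m + (c.bin + 1)) / 2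
        else p j

/-- The mechanism for given outcomes of its random coins. -/
noncomputable def mechAlg (c : MechCoins n m) : QueryAlg n m (Outcome n m) :=
  if c.grand then secondPriceAuction
  else do
    let apx ← greedy c.statBidders (List.finRange m) fun _ => ∅
    let x ← askValues apx c.statBidders
    chunkLoop c (∑ i, x i) (List.finRange (numChunks m)) fun _ => 0

/-- The randomized mechanism that is induced by the algorithm `mechAlg` if demand queries to
bidder `i` are answered according to `D i`. -/
noncomputable def mechanism (D : Fin n → SetValuation m → (Fin m → ℝ) → Finset (Fin m)) :
    RandomizedMechanism n m where
  Coins := MechCoins n m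
  law := PMF.uniformOfFintype (MechCoins n m)
  det c := fun v => (mechAlg c).run D v

end Mechanism

end CombAuction

open CombAuction

namespace CombAuction

/-! ### Running algorithms and counting queries -/

namespace QueryAlg

variable {n m : ℕ} {α β : Type} {D : Fin n → SetValuation m → (Fin m → ℝ) → Finset (Fin m)}
  {v : Fin n → SetValuation m}

/-! Truthfulness holds coin by coin. A bidder in STAT receives nothing and pays nothing. A bidder in
UNIFORM obtains something only from the auction at which the coins stop, and its prices depend on
STAT alone. A bidder in FINAL meets prices fixed by STAT and UNIFORM. Each relevant auction is thus
a choice at prices, from a set of items, that the bidder's own report cannot influence.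

For the welfare, take an optimal allocation $O$ with XOS supporting prices $q_j$
(`exists_supporting_allocation`), and let $t$ be the bidder with the largest value of $M$. The
second price auction pays for $v_t(M)$. In the other branch consider only the groupings with $t$ in
STAT. The greedy estimate $w$ then satisfies $v_t(M)/m\le w\le\mathrm{OPT}$, so every $q_j$ either
lies in a bin or is at most $4\,\mathrm{OPT}/m^2$ (`hasBin_or_le`). For $m\ge 8$ the small items
lose at most half of OPT.

Let $j\in O_i$ with $i\ne t$ in FINAL, and let $k$ be the chunk of $q_j$. There are three cases
(`le_gain_of_final`). If $j$ is unsold in auction $k$, then $j$ would still be there on the arrival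
of $i$, were $i$ in UNIFORM. If $j$ is sold in a later auction, that auction collects at least
$q_j/2$ for it. Otherwise $k$ is the last auction that sells $j$, and for the right $r$ the final
price of $j$ lies between $q_j/4$ and $q_j/2$. The first case is charged to the grouping in which
$i$ has moved to UNIFORM; the move is injective and leaves $w$ unchanged (`le_sum_gain`).

Hence the items are paid for, up to constants, by the sum over the $\alpha$ chunk auctions plus the
sum over the $L$ choices of $r$ of the final auction (`sum_gain_le`). Each chunk auction is the
outcome with probability of order $1/\alpha$, and the final auction for a given $r$ with probability
of order $1/L$ (`le_sum_halt`). Both $\alpha$ and $L$ are $O(\sqrt{\log m})$. The comparison works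
for each fixed arrival order. -/

theorem run_bind (x : QueryAlg n m α) (f : α → QueryAlg n m β) :
    (x >>= f).run D v = (f (x.run D v)).run D v := by
  change (x.bind f).run D v = _
  induction x with
  | ret a => rfl
  | value i S k ih => exact ih _
  | demand i p k ih => exact ih _

@[simp] theorem run_pure (a : α) : (pure a : QueryAlg n m α).run D v = a := rfl

@[simp] theorem run_askValue (i : Fin n) (S : Finset (Fin m)) :
    (askValue i S).run D v = v i S := rfl

@[simp] theorem run_askDemand (i : Fin n) (p : Fin m → ℝ) :
    (askDemand i p).run D v = D i (v i) p := rfl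

theorem AsksAtMost.mono {x : QueryAlg n m α} {q q' : ℕ} (h : x.AsksAtMost q) (hq : q ≤ q') :
    x.AsksAtMost q' := by
  induction x generalizing q q' with
  | ret a => trivial
  | value i S k ih => exact ⟨h.1.trans_le hq, fun y => ih y (h.2 y) (by omega)⟩
  | demand i p k ih => exact ⟨h.1.trans_le hq, fun y => ih y (h.2 y) (by omega)⟩

theorem AsksAtMost.bind {x : QueryAlg n m α} {f : α → QueryAlg n m β} {q q' : ℕ}
    (h : x.AsksAtMost q) (hf : ∀ a, (f a).AsksAtMost q') : (x >>= f).AsksAtMost (q + q') := by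
  change (x.bind f).AsksAtMost _
  induction x generalizing q with
  | ret a => exact (hf a).mono (by omega)
  | value i S k ih =>
    obtain ⟨h0, h⟩ := h
    exact ⟨by omega, fun y => (ih y (h y)).mono (by omega)⟩
  | demand i p k ih =>
    obtain ⟨h0, h⟩ := h
    exact ⟨by omega, fun y => (ih y (h y)).mono (by omega)⟩

theorem asksAtMost_pure (a : α) (q : ℕ) : (pure a : QueryAlg n m α).AsksAtMost q := trivial

theorem asksAtMost_askValue (i : Fin n) (S : Finset (Fin m)) : (askValue i S).AsksAtMost 1 :=
  ⟨one_pos, fun _ => trivial⟩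

theorem asksAtMost_askDemand (i : Fin n) (p : Fin m → ℝ) : (askDemand i p).AsksAtMost 1 :=
  ⟨one_pos, fun _ => trivial⟩

end QueryAlg

open QueryAlg

/-! ### Query bounds -/

section Queries

variable {n m : ℕ}

theorem asksAtMost_askValues (S : Bundles n m) (l : List (Fin n)) :
    (askValues S l).AsksAtMost l.length := by
  induction l with
  | nil => trivial
  | cons i l ih =>
    exact ((asksAtMost_askValue i (S i)).bind fun x => ih.bind fun b =>
      asksAtMost_pure _ 0).mono (by simp only [List.length_cons]; omega)

theorem asksAtMost_secondPriceAuction : (secondPriceAuction : QueryAlg n m _).AsksAtMost n := by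
  refine ((asksAtMost_askValues _ _).bind (q' := 0) fun b => ?_).mono (by simp)
  cases (List.finRange n).argmax b <;> exact asksAtMost_pure _ 0

theorem asksAtMost_greedy (N : List (Fin n)) (items : List (Fin m)) (A : Bundles n m) :
    (greedy N items A).AsksAtMost (2 * N.length * items.length) := by
  induction items generalizing A with
  | nil => trivial
  | cons j items ih =>
    refine ((asksAtMost_askValues (fun i => insert j (A i)) N).bind fun x =>
      (asksAtMost_askValues A N).bind (q' := 2 * N.length * items.length) fun y => ?_).mono
        (by simp only [List.length_cons]; nlinarith)
    cases N.argmax fun i => x i - y i <;> exact ih _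

theorem asksAtMost_fixedPriceAuction (p : Fin m → ℝ) (l : List (Fin n)) (rest : Finset (Fin m)) :
    (fixedPriceAuction p l rest).AsksAtMost (2 * l.length) := by
  induction l generalizing rest with
  | nil => trivial
  | cons i l ih =>
    exact ((asksAtMost_askValue i _).bind fun x => (asksAtMost_askDemand i _).bind fun S =>
      (ih _).bind fun T => asksAtMost_pure _ 0).mono (by simp only [List.length_cons]; omega)

theorem length_statBidders_le (c : MechCoins n m) : c.statBidders.length ≤ n :=
  (List.length_filter_le _ _).trans (by simp)

theorem length_uniformBidders_le (c : MechCoins n m) : c.uniformBidders.length ≤ n :=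
  (List.length_filter_le _ _).trans (by simp)

theorem length_finalBidders_le (c : MechCoins n m) : c.finalBidders.length ≤ n :=
  (List.length_filter_le _ _).trans (by simp)

theorem asksAtMost_chunkLoop (c : MechCoins n m) (w : ℝ) (ks : List (Fin (numChunks m)))
    (p : Fin m → ℝ) : (chunkLoop c w ks p).AsksAtMost (2 * n * (ks.length + 1)) := by
  induction ks generalizing p with
  | nil =>
    exact ((asksAtMost_fixedPriceAuction p _ _).bind fun T => asksAtMost_pure _ 0).mono
      (by have := length_finalBidders_le c; simpa using by omega)
  | cons k ks ih =>
    refine ((asksAtMost_fixedPriceAuction _ _ _).bind (q' := 2 * n * (ks.length + 1))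
      fun T => ?_).mono (q := 2 * c.uniformBidders.length + 2 * n * (ks.length + 1)) ?_
    · by_cases h : c.halt k = 0
      · simpa only [h, if_true] using asksAtMost_pure _ _
      · simpa only [h, if_false] using ih _
    · have := length_uniformBidders_le c
      simp only [List.length_cons]
      nlinarith

theorem numChunks_le (m : ℕ) : numChunks m ≤ m + 1 := by
  refine max_le (by omega) (Nat.ceil_le.2 ?_)
  rw [Real.sqrt_le_left (by positivity)]
  -- For `m = 0` the logarithm has the default value `0`.
  rcases Nat.eq_zero_or_pos m with rfl | hm
  · simp
  · have h2 : (m : ℝ) ≤ 2 ^ (m : ℝ) := by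
      rw [Real.rpow_natCast]
      exact_mod_cast (Nat.lt_two_pow_self (n := m)).le
    have h : Real.logb 2 m ≤ m := by
      rw [Real.logb_le_iff_le_rpow (by norm_num) (by exact_mod_cast hm)]
      exact h2
    push_cast
    nlinarith [(Nat.cast_nonneg m : (0 : ℝ) ≤ m)]

theorem asksAtMost_mechAlg (c : MechCoins n m) :
    (mechAlg c).AsksAtMost (10 * (n + m) ^ 2 + 10) := by
  unfold mechAlg
  split_ifs
  · exact asksAtMost_secondPriceAuction.mono
      (by nlinarith [Nat.le_self_pow two_ne_zero (n + m)])
  · refine ((asksAtMost_greedy _ _ _).bind fun A => (asksAtMost_askValues A _).bind fun x =>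
      asksAtMost_chunkLoop c _ _ _).mono ?_
    have h := length_statBidders_le c
    have h' := numChunks_le m
    simp only [List.length_finRange]
    have h1 : 2 * c.statBidders.length * m ≤ 2 * n * m := by gcongr
    have h2 : 2 * n * (numChunks m + 1) ≤ 2 * n * (m + 1 + 1) := by gcongr
    nlinarith [Nat.le_self_pow two_ne_zero (n + m), sq_nonneg ((n : ℤ) - m)]

end Queries

/-! ### XOS valuations -/

section XOS

variable {m : ℕ}

theorem IsValuation.nonneg {v : SetValuation m} (h : IsValuation v) (S : Finset (Fin m)) :
    0 ≤ v S := h.1 ▸ h.2 ∅ S (Finset.empty_subset S)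

theorem IsXOS.isValuation {v : SetValuation m} (h : IsXOS v) : IsValuation v := by
  obtain ⟨t, a, ha, hv⟩ := h
  constructor
  · obtain ⟨r, hr⟩ := (hv ∅).1
    rw [← hr]
    exact (ha r).1.1
  · intro S T hST
    obtain ⟨r, hr⟩ := (hv S).1
    rw [← hr]
    exact ((ha r).1.2 S T hST).trans ((hv T).2 ⟨r, rfl⟩)

/-- Supporting prices of the bundle `T`. -/
theorem IsXOS.exists_supporting {v : SetValuation m} (h : IsXOS v) (T : Finset (Fin m)) :
    ∃ q : Fin m → ℝ, (∀ j, 0 ≤ q j) ∧ v T = ∑ j ∈ T, q j ∧ ∀ S, ∑ j ∈ S, q j ≤ v S := by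
  obtain ⟨t, a, ha, hv⟩ := h
  obtain ⟨r, hr⟩ := (hv T).1
  refine ⟨fun j => a r {j}, fun j => (ha r).1.nonneg _, ?_, fun S => ?_⟩
  · rw [← hr]
    exact (ha r).2 T
  · rw [← (ha r).2 S]
    exact (hv S).2 ⟨r, rfl⟩

theorem IsXOS.le_sum_singleton {v : SetValuation m} (h : IsXOS v) (T : Finset (Fin m)) :
    v T ≤ ∑ j ∈ T, v {j} := by
  obtain ⟨q, -, hT, hq⟩ := h.exists_supporting T
  rw [hT]
  exact Finset.sum_le_sum fun j _ => by simpa using hq {j}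

/-- The marginal values telescope when the items are added in increasing order. -/
theorem sum_marginals {v : SetValuation m} (T : Finset (Fin m)) :
    ∑ j ∈ T, (v {i ∈ T | i ≤ j} - v {i ∈ T | i < j}) = v T - v ∅ := by
  induction T using Finset.induction_on_max with
  | empty => simp
  | insert a T ha ih =>
    have hn : a ∉ T := fun h => lt_irrefl _ (ha a h)
    rw [Finset.sum_insert hn]
    have h1 : {i ∈ insert a T | i ≤ a} = insert a T :=
      Finset.filter_true_of_mem fun i hi => by
        rcases Finset.mem_insert.1 hi with rfl | h
        exacts [le_rfl, (ha i h).le]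
    have h2 : {i ∈ insert a T | i < a} = T := by
      rw [Finset.filter_insert, if_neg (lt_irrefl a)]
      exact Finset.filter_true_of_mem fun i hi => ha i hi
    have h3 : ∑ j ∈ T, (v {i ∈ insert a T | i ≤ j} - v {i ∈ insert a T | i < j})
        = ∑ j ∈ T, (v {i ∈ T | i ≤ j} - v {i ∈ T | i < j}) := by
      refine Finset.sum_congr rfl fun j hj => ?_
      rw [Finset.filter_insert, if_neg (not_le.2 (ha j hj)), Finset.filter_insert,
        if_neg (not_lt.2 (ha j hj).le)]
    rw [h1, h2, h3, ih]
    ring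

theorem IsSubmodular.marginal_anti {v : SetValuation m} (h : IsSubmodular v)
    {S T : Finset (Fin m)} (hST : S ⊆ T) {j : Fin m} (hj : j ∈ S) :
    v {i ∈ T | i ≤ j} - v {i ∈ T | i < j} ≤ v {i ∈ S | i ≤ j} - v {i ∈ S | i < j} := by
  -- The union of these two sets is the part of `T` up to `j`, and their intersection is the part of
  -- `S` below `j`.
  have key := h {i ∈ S | i ≤ j} {i ∈ T | i < j}
  have h1 : {i ∈ S | i ≤ j} ∪ {i ∈ T | i < j} = {i ∈ T | i ≤ j} := by
    ext i
    simp only [Finset.mem_union, Finset.mem_filter]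
    constructor
    · rintro (⟨a, b⟩ | ⟨a, b⟩)
      exacts [⟨hST a, b⟩, ⟨a, b.le⟩]
    · rintro ⟨a, b⟩
      rcases b.eq_or_lt with rfl | b
      exacts [Or.inl ⟨hj, le_rfl⟩, Or.inr ⟨a, b⟩]
  have h2 : {i ∈ S | i ≤ j} ∩ {i ∈ T | i < j} = {i ∈ S | i < j} := by
    ext i
    simp only [Finset.mem_inter, Finset.mem_filter]
    exact ⟨fun h => ⟨h.1.1, h.2.2⟩, fun h => ⟨⟨h.1, h.2.le⟩, hST h.1, h.2⟩⟩
  rw [h1, h2] at key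
  linarith

/-- There is one clause per bundle `T`, giving an item of `T` its marginal value over the preceding
items of `T`. The clause is exact on `T` by telescoping. Elsewhere it does not exceed `v`, since the
marginals only grow when `T` shrinks to `S ∩ T`. -/
theorem IsSubmodular.isXOS {v : SetValuation m} (hv : IsValuation v) (h : IsSubmodular v) :
    IsXOS v := by
  classical
  let e := Fintype.equivFin (Finset (Fin m))
  let c : Finset (Fin m) → Fin m → ℝ := fun T j =>
    if j ∈ T then v {i ∈ T | i ≤ j} - v {i ∈ T | i < j} else 0
  have hc : ∀ T j, 0 ≤ c T j := by
    intro T j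
    simp only [c]
    split_ifs
    · exact sub_nonneg.2 (hv.2 _ _ (Finset.monotone_filter_right _ fun i _ hi => le_of_lt hi))
    · exact le_rfl
  refine ⟨_, fun r S => ∑ j ∈ S, c (e.symm r) j, fun r => ⟨⟨by simp, fun S T hST => ?_⟩, ?_⟩,
    fun S => ⟨⟨e S, ?_⟩, ?_⟩⟩
  · exact Finset.sum_le_sum_of_subset_of_nonneg hST fun j _ _ => hc _ j
  · intro S
    simp
  · simp only [Equiv.symm_apply_apply]
    rw [Finset.sum_congr rfl fun j hj => if_pos hj, sum_marginals, hv.1, sub_zero]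
  · rintro _ ⟨r, rfl⟩
    change ∑ j ∈ S, c (e.symm r) j ≤ v S
    generalize e.symm r = T
    calc ∑ j ∈ S, c T j = ∑ j ∈ S ∩ T, c T j := by
          refine (Finset.sum_subset Finset.inter_subset_left fun j hj hj' => ?_).symm
          exact if_neg fun hT => hj' (Finset.mem_inter.2 ⟨hj, hT⟩)
      _ ≤ ∑ j ∈ S ∩ T, (v {i ∈ S ∩ T | i ≤ j} - v {i ∈ S ∩ T | i < j}) := by
          refine Finset.sum_le_sum fun j hj => ?_
          simp only [c, if_pos (Finset.mem_inter.1 hj).2]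
          exact h.marginal_anti Finset.inter_subset_right hj
      _ = v (S ∩ T) := by rw [sum_marginals, hv.1, sub_zero]
      _ ≤ v S := hv.2 _ _ Finset.inter_subset_left

end XOS

/-! ### Fixed price auctions -/

section FixedPrice

variable {n m : ℕ} (D : Fin n → SetValuation m → (Fin m → ℝ) → Finset (Fin m))
  (v : Fin n → SetValuation m) (p : Fin m → ℝ)

/-- The bundle bought by bidder `i` if the items in `rest` are offered. -/
noncomputable def pick (i : Fin n) (rest : Finset (Fin m)) : Finset (Fin m) :=
  D i (v i) fun j => if j ∈ rest then p j else v i Finset.univ + 1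

/-- The outcome of a fixed price auction. -/
noncomputable def fpa (l : List (Fin n)) (rest : Finset (Fin m)) : Bundles n m :=
  (fixedPriceAuction p l rest).run D v

/-- The items available to bidder `i` on arrival in a fixed price auction; for an absent bidder,
the items that remain at the end. -/
noncomputable def availableAt : List (Fin n) → Finset (Fin m) → Fin n → Finset (Fin m)
  | [], rest, _ => rest
  | k :: l, rest, i => if k = i then rest else availableAt l (rest \ pick D v p k rest) i

/-- The items sold in a fixed price auction. -/
noncomputable def sold (l : List (Fin n)) (rest : Finset (Fin m)) : Finset (Fin m) :=
  Finset.univ.biUnion (fpa D v p l rest)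

@[simp] theorem fpa_nil (rest : Finset (Fin m)) : fpa D v p [] rest = fun _ => ∅ := rfl

theorem fpa_cons (k : Fin n) (l : List (Fin n)) (rest : Finset (Fin m)) :
    fpa D v p (k :: l) rest =
      Function.update (fpa D v p l (rest \ pick D v p k rest)) k (pick D v p k rest) := by
  simp only [fpa, fixedPriceAuction, run_bind, run_askValue, run_askDemand, run_pure, pick]

/-- Should a bidder occur twice, the first arrival counts on both sides: the outer `Function.update`
overrides the tail, and `availableAt` stops at the first match. -/
theorem fpa_apply (l : List (Fin n)) (rest : Finset (Fin m)) (i : Fin n) :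
    fpa D v p l rest i = if i ∈ l then pick D v p i (availableAt D v p l rest i) else ∅ := by
  induction l generalizing rest with
  | nil => simp
  | cons k l ih =>
    rw [fpa_cons]
    by_cases h : k = i
    · subst h
      simp [availableAt]
    · rw [Function.update_of_ne (Ne.symm h), ih]
      simp [availableAt, h, Ne.symm h]

variable {D v p}

theorem fpa_of_notMem {l : List (Fin n)} {i : Fin n} (h : i ∉ l) (rest : Finset (Fin m)) :
    fpa D v p l rest i = ∅ := by
  rw [fpa_apply, if_neg h]

theorem pick_congr {v' : Fin n → SetValuation m} {i : Fin n} (h : v i = v' i)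
    (rest : Finset (Fin m)) : pick D v p i rest = pick D v' p i rest := by
  simp only [pick, h]

theorem fpa_congr {v' : Fin n → SetValuation m} {l : List (Fin n)} (h : ∀ i ∈ l, v i = v' i)
    (rest : Finset (Fin m)) : fpa D v p l rest = fpa D v' p l rest := by
  induction l generalizing rest with
  | nil => rfl
  | cons k l ih =>
    rw [fpa_cons, fpa_cons, pick_congr (h k (by simp)), ih fun i hi => h i (by simp [hi])]

/-- Only the bidders who arrive earlier decide what is left; this is the source of truthfulness of a
fixed price auction. -/
theorem availableAt_update (l : List (Fin n)) (rest : Finset (Fin m)) (i : Fin n)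
    (x : SetValuation m) :
    availableAt D (Function.update v i x) p l rest i = availableAt D v p l rest i := by
  induction l generalizing rest with
  | nil => rfl
  | cons k l ih =>
    by_cases h : k = i
    · simp [availableAt, h]
    · rw [availableAt, availableAt, if_neg h, if_neg h, ih,
        pick_congr (Function.update_of_ne h _ _)]

theorem availableAt_subset (l : List (Fin n)) (rest : Finset (Fin m)) (i : Fin n) :
    availableAt D v p l rest i ⊆ rest := by
  induction l generalizing rest with
  | nil => exact subset_rfl
  | cons k l ih =>
    by_cases h : k = i
    · simp [availableAt, h]
    · rw [availableAt, if_neg h]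
      exact (ih _).trans Finset.sdiff_subset

/-- Removing a bidder does not increase what is available to this bidder. -/
theorem availableAt_filter_subset (l : List (Fin n)) (rest : Finset (Fin m)) (i : Fin n) :
    availableAt D v p (l.filter fun k => k ≠ i) rest i ⊆ availableAt D v p l rest i := by
  induction l generalizing rest with
  | nil => exact subset_rfl
  | cons k l ih =>
    by_cases h : k = i
    · simpa [availableAt, h] using availableAt_subset _ _ _
    · simpa [availableAt, h] using ih _

theorem sold_cons {k : Fin n} {l : List (Fin n)} (h : k ∉ l) (rest : Finset (Fin m)) :
    sold D v p (k :: l) rest = pick D v p k rest ∪ sold D v p l (rest \ pick D v p k rest) := by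
  ext j
  simp only [sold, Finset.mem_biUnion, Finset.mem_univ, true_and, Finset.mem_union, fpa_cons]
  constructor
  · rintro ⟨i, hi⟩
    by_cases hik : i = k
    · subst hik
      exact Or.inl (by simpa using hi)
    · exact Or.inr ⟨i, by simpa [hik] using hi⟩
  · rintro (hj | ⟨i, hi⟩)
    · exact ⟨k, by simpa using hj⟩
    · refine ⟨i, ?_⟩
      rwa [Function.update_of_ne]
      rintro rfl
      simp [fpa_of_notMem h] at hi

theorem availableAt_of_notMem {l : List (Fin n)} (hl : l.Nodup) (rest : Finset (Fin m))
    {i : Fin n} (hi : i ∉ l) : availableAt D v p l rest i = rest \ sold D v p l rest := by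
  induction l generalizing rest with
  | nil =>
    ext j
    simp [availableAt, sold]
  | cons k l ih =>
    rw [List.nodup_cons] at hl
    rw [List.mem_cons, not_or] at hi
    rw [availableAt, if_neg (Ne.symm hi.1), ih hl.2 _ hi.2, sold_cons hl.1, sdiff_sdiff_left]
    rfl

/-- An item that is never sold was on offer at every arrival. -/
theorem sdiff_sold_subset_availableAt {l : List (Fin n)} (hl : l.Nodup) (rest : Finset (Fin m))
    (i : Fin n) : rest \ sold D v p l rest ⊆ availableAt D v p l rest i := by
  induction l generalizing rest with
  | nil => exact Finset.sdiff_subset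
  | cons k l ih =>
    rw [List.nodup_cons] at hl
    by_cases h : k = i
    · simp [availableAt, h]
    · rw [availableAt, if_neg h, sold_cons hl.1]
      refine subset_trans (subset_of_eq ?_) (ih hl.2 _)
      rw [sdiff_sdiff_left]
      rfl

variable (hD : ∀ i, IsDemandRule (D i)) (hp : ∀ j, 0 ≤ p j)

include hD hp

/-- An excluded item costs more than the value of the set of all items, so a bundle containing it
has negative profit, whereas `∅` has profit zero. -/
theorem pick_subset {i : Fin n} (hv : IsValuation (v i)) (rest : Finset (Fin m)) :
    pick D v p i rest ⊆ rest := by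
  by_contra hsub
  obtain ⟨j, hj, hjr⟩ := Finset.not_subset.1 hsub
  have h := hD i (v i) (fun j => if j ∈ rest then p j else v i Finset.univ + 1) ∅
  change _ ≤ v i (pick D v p i rest) - ∑ j ∈ pick D v p i rest, _ at h
  have h0 := hv.nonneg Finset.univ
  have h1 := Finset.single_le_sum
    (f := fun j => if j ∈ rest then p j else v i Finset.univ + 1)
    (fun j _ => by split_ifs; exacts [hp j, by linarith]) hj
  have h2 := hv.2 _ _ (Finset.subset_univ (pick D v p i rest))
  simp only [hjr, if_false] at h1
  rw [hv.1, Finset.sum_empty] at h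
  linarith

theorem le_profit_pick {i : Fin n} (hv : IsValuation (v i)) {S rest : Finset (Fin m)}
    (hS : S ⊆ rest) :
    v i S - ∑ j ∈ S, p j ≤ v i (pick D v p i rest) - ∑ j ∈ pick D v p i rest, p j := by
  have h := hD i (v i) (fun j => if j ∈ rest then p j else v i Finset.univ + 1) S
  change _ ≤ v i (pick D v p i rest) - ∑ j ∈ pick D v p i rest, _ at h
  rwa [Finset.sum_congr rfl fun j hj => if_pos (hS hj),
    Finset.sum_congr rfl fun j hj => if_pos (pick_subset hD hp hv rest hj)] at h

theorem fpa_disjoint (hv : ∀ i, IsValuation (v i)) (l : List (Fin n)) (rest : Finset (Fin m)) :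
    (∀ i, fpa D v p l rest i ⊆ rest) ∧ IsAllocation (fpa D v p l rest) := by
  induction l generalizing rest with
  | nil => exact ⟨fun i => Finset.empty_subset _, fun i i' _ => Finset.disjoint_empty_left _⟩
  | cons k l ih =>
    obtain ⟨h1, h2⟩ := ih (rest \ pick D v p k rest)
    rw [fpa_cons]
    have hk : ∀ i, Disjoint (pick D v p k rest) (fpa D v p l (rest \ pick D v p k rest) i) :=
      fun i => Finset.disjoint_of_subset_right (h1 i) Finset.disjoint_sdiff
    constructor
    · intro i
      by_cases hi : i = k
      · subst hi
        simpa using pick_subset hD hp (hv i) rest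
      · rw [Function.update_of_ne hi]
        exact (h1 i).trans Finset.sdiff_subset
    · intro i i' hii'
      by_cases hi : i = k
      · subst hi
        rw [Function.update_self, Function.update_of_ne hii'.symm]
        exact hk _
      · by_cases hi' : i' = k
        · subst hi'
          rw [Function.update_self, Function.update_of_ne hii']
          exact (hk _).symm
        · rw [Function.update_of_ne hi, Function.update_of_ne hi']
          exact h2 i i' hii'

/-- The bundle obtained by misreporting is a subset of the same available items, so it was among the
options of the truthful bidder. -/
theorem fpa_truthful (hv : ∀ i, IsValuation (v i)) (l : List (Fin n)) (rest : Finset (Fin m))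
    (i : Fin n) {x : SetValuation m} (hx : IsValuation x) :
    v i (fpa D (Function.update v i x) p l rest i)
        - ∑ j ∈ fpa D (Function.update v i x) p l rest i, p j
      ≤ v i (fpa D v p l rest i) - ∑ j ∈ fpa D v p l rest i, p j := by
  rw [fpa_apply, fpa_apply, availableAt_update]
  split_ifs
  · exact le_profit_pick hD hp (hv i) (pick_subset hD hp (by simpa using hx) _)
  · exact le_rfl

/-- The welfare of a fixed price auction is the profit of the bidders plus the revenue, where
each bidder could have bought any available part of a given bundle. -/
theorem le_welfare_fpa (hv : ∀ i, IsValuation (v i)) {l : List (Fin n)} (rest : Finset (Fin m))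
    {q : Fin m → ℝ} {G : Bundles n m} (hq : ∀ i, ∀ S ⊆ G i, ∑ j ∈ S, q j ≤ v i S) :
    (∑ i with i ∈ l, ∑ j ∈ G i ∩ availableAt D v p l rest i, (q j - p j))
        + ∑ j ∈ sold D v p l rest, p j
      ≤ welfare v (fpa D v p l rest) := by
  -- The revenue is split by buyer, so that for each bidder profit plus payment is the value of the
  -- bundle bought.
  have h1 : ∑ j ∈ sold D v p l rest, p j = ∑ i, ∑ j ∈ fpa D v p l rest i, p j :=
    Finset.sum_biUnion fun i _ i' _ h => (fpa_disjoint hD hp hv l rest).2 i i' h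
  rw [h1, welfare, Finset.sum_filter, ← Finset.sum_add_distrib]
  refine Finset.sum_le_sum fun i _ => ?_
  rw [fpa_apply]
  split_ifs
  · have h2 := le_profit_pick hD hp (hv i)
      (Finset.inter_subset_right : G i ∩ availableAt D v p l rest i ⊆ _)
    have h3 := hq i _ (Finset.inter_subset_left : G i ∩ availableAt D v p l rest i ⊆ _)
    rw [Finset.sum_sub_distrib]
    linarith
  · simp [(hv i).1]

end FixedPrice

/-! ### The greedy algorithm -/

section Greedy

variable {n m : ℕ} {D : Fin n → SetValuation m → (Fin m → ℝ) → Finset (Fin m)}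
  {v : Fin n → SetValuation m}

theorem run_askValues (S : Bundles n m) (l : List (Fin n)) :
    (askValues S l).run D v = fun i => if i ∈ l then v i (S i) else 0 := by
  induction l with
  | nil => simp [askValues]
  | cons k l ih =>
    rw [askValues, run_bind, run_bind, ih]
    ext i
    by_cases h : i = k
    · subst h
      simp
    · simp [h]

theorem run_askValues_congr {v' : Fin n → SetValuation m} {l : List (Fin n)}
    (h : ∀ i ∈ l, v i = v' i) (S : Bundles n m) :
    (askValues S l).run D v = (askValues S l).run D v' := by
  rw [run_askValues, run_askValues]
  ext i
  split_ifs with hi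
  · rw [h i hi]
  · rfl

theorem run_greedy_congr {v' : Fin n → SetValuation m} {N : List (Fin n)}
    (h : ∀ i ∈ N, v i = v' i) (items : List (Fin m)) (A : Bundles n m) :
    (greedy N items A).run D v = (greedy N items A).run D v' := by
  induction items generalizing A with
  | nil => rfl
  | cons j items ih =>
    simp only [greedy, run_bind, run_askValues_congr h]
    split <;> exact ih _

/-- For the last claim: when item `j` is treated, the welfare grows by at least the marginal value
of bidder `i` for `j`. Together with the share `v i (A i)` already contained in the welfare this is
at least `v i {j}`. No approximation guarantee of greedy beyond this is needed. -/
theorem run_greedy_spec (hv : ∀ i, IsValuation (v i)) (N : List (Fin n)) {items : List (Fin m)}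
    (hitems : items.Nodup) {A : Bundles n m} (hA : IsAllocation A)
    (hAi : ∀ j ∈ items, ∀ i, j ∉ A i) (hN : ∀ i ∉ N, A i = ∅) :
    IsAllocation ((greedy N items A).run D v) ∧
      (∀ i ∉ N, (greedy N items A).run D v i = ∅) ∧
      welfare v A ≤ welfare v ((greedy N items A).run D v) ∧
      ∀ i ∈ N, ∀ j ∈ items, v i {j} ≤ welfare v ((greedy N items A).run D v) := by
  induction items generalizing A with
  | nil => exact ⟨hA, hN, le_rfl, by simp⟩
  | cons j items ih =>
    rw [List.nodup_cons] at hitems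
    simp only [greedy, run_bind, run_askValues]
    split
    · next h =>
      rw [List.argmax_eq_none] at h
      subst h
      obtain ⟨h1, h2, h3, h4⟩ := ih hitems.2 hA (fun j hj => hAi j (by simp [hj])) hN
      exact ⟨h1, h2, h3, by simp⟩
    · next k h =>
      have hk : k ∈ N := List.argmax_mem h
      have hj : ∀ i, j ∉ A i := hAi j (by simp)
      have hself := Function.update_self k (insert j (A k)) A
      have hne : ∀ i, i ≠ k → Function.update A k (insert j (A k)) i = A i :=
        fun i hi => Function.update_of_ne hi _ _
      obtain ⟨h1, h2, h3, h4⟩ := ih hitems.2 (A := Function.update A k (insert j (A k)))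
        (by
          intro i i' hii'
          by_cases hi : i = k
          · subst hi
            rw [hself, hne _ hii'.symm, Finset.disjoint_insert_left]
            exact ⟨hj i', hA _ _ hii'⟩
          · by_cases hi' : i' = k
            · subst hi'
              rw [hself, hne _ hi, Finset.disjoint_insert_right]
              exact ⟨hj i, hA _ _ hii'⟩
            · rw [hne _ hi, hne _ hi']
              exact hA _ _ hii')
        (by
          intro j' hj' i
          by_cases hi : i = k
          · subst hi
            rw [hself, Finset.mem_insert, not_or]
            exact ⟨fun h => hitems.1 (h ▸ hj'), hAi j' (by simp [hj']) _⟩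
          · rw [hne _ hi]
            exact hAi j' (by simp [hj']) _)
        (by
          intro i hi
          rw [hne _ (by rintro rfl; exact hi hk)]
          exact hN i hi)
      have hw : welfare v (Function.update A k (insert j (A k)))
          = welfare v A + (v k (insert j (A k)) - v k (A k)) := by
        simp only [welfare]
        rw [← Finset.add_sum_erase _ _ (Finset.mem_univ k),
          ← Finset.add_sum_erase _ (fun i => v i (A i)) (Finset.mem_univ k), hself,
          Finset.sum_congr rfl fun i hi => by rw [hne i (Finset.ne_of_mem_erase hi)]]
        ring
      have hk' := (hv k).2 _ _ (Finset.subset_insert j (A k))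
      refine ⟨h1, h2, by linarith, fun i hi j' hj' => ?_⟩
      rcases List.mem_cons.1 hj' with rfl | hj'
      · have hmax := List.le_of_mem_argmax hi h
        simp only [hi, hk, if_true] at hmax
        have h5 := (hv i).2 {j'} (insert j' (A i)) (by simp)
        have h6 : v i (A i) ≤ welfare v A :=
          Finset.single_le_sum (f := fun i => v i (A i)) (fun i _ => (hv i).nonneg _)
            (Finset.mem_univ i)
        linarith
      · exact h4 i hi j' hj'

variable (D v) in
/-- The welfare estimate that is computed from the bidders in `N`. -/
noncomputable def greedyWelfare (N : List (Fin n)) : ℝ :=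
  ∑ i, (askValues ((greedy N (List.finRange m) fun _ => ∅).run D v) N).run D v i

theorem greedyWelfare_congr {v' : Fin n → SetValuation m} {N : List (Fin n)}
    (h : ∀ i ∈ N, v i = v' i) : greedyWelfare D v N = greedyWelfare D v' N := by
  rw [greedyWelfare, run_greedy_congr h, run_askValues_congr h, greedyWelfare]

theorem greedyWelfare_spec (hv : ∀ i, IsValuation (v i)) (N : List (Fin n)) :
    (∃ A, IsAllocation A ∧ greedyWelfare D v N = welfare v A) ∧
      ∀ i ∈ N, ∀ j, v i {j} ≤ greedyWelfare D v N := by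
  obtain ⟨h1, h2, -, h4⟩ := run_greedy_spec (D := D) hv N (List.nodup_finRange m)
    (A := fun _ => ∅) (fun _ _ _ => Finset.disjoint_empty_left _) (by simp) (by simp)
  have h : greedyWelfare D v N
      = welfare v ((greedy N (List.finRange m) fun _ => ∅).run D v) := by
    rw [greedyWelfare, run_askValues, welfare]
    refine Finset.sum_congr rfl fun i _ => ?_
    dsimp only
    split_ifs with hi
    · rfl
    · rw [h2 i hi, (hv i).1]
  exact ⟨⟨_, h1, h⟩, fun i hi j => h ▸ h4 i hi j (List.mem_finRange j)⟩

end Greedy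

/-! ### The second price auction -/

section SecondPrice

variable {n m : ℕ} {D : Fin n → SetValuation m → (Fin m → ℝ) → Finset (Fin m)}
  {v : Fin n → SetValuation m}

/-- The second price auction run on the bids `b`. -/
noncomputable def secondPriceOutcome (m : ℕ) (b : Fin n → ℝ) : Outcome n m :=
  match (List.finRange n).argmax b with
  | none => ⟨fun _ => ∅, fun _ => 0⟩
  | some w => ⟨fun i => if i = w then Finset.univ else ∅,
      fun i => if i = w then (Finset.univ.erase w).fold max 0 b else 0⟩

theorem run_secondPriceAuction :
    (secondPriceAuction : QueryAlg n m _).run D v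
      = secondPriceOutcome m fun i => v i Finset.univ := by
  simp only [secondPriceAuction, run_bind, run_askValues, List.mem_finRange, if_true,
    secondPriceOutcome]
  cases (List.finRange n).argmax fun i => v i Finset.univ <;> rfl

theorem secondPriceOutcome_isAllocation (b : Fin n → ℝ) :
    IsAllocation (secondPriceOutcome m b).alloc := by
  intro i i' h
  unfold secondPriceOutcome
  split
  · exact Finset.disjoint_empty_left _
  · next w _ =>
    by_cases hi : i = w
    · subst hi
      simp [h.symm]
    · simp [hi]

/-- The index `i` only certifies that there is a bidder, which rules out the empty maximum. -/
theorem secondPriceOutcome_eq (b : Fin n → ℝ) (i : Fin n) :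
    ∃ w, (∀ k, b k ≤ b w) ∧ secondPriceOutcome m b =
      ⟨fun i => if i = w then Finset.univ else ∅,
        fun i => if i = w then (Finset.univ.erase w).fold max 0 b else 0⟩ := by
  unfold secondPriceOutcome
  split
  · next h =>
    rw [List.argmax_eq_none] at h
    have := List.mem_finRange i
    simp [h] at this
  · next w h =>
    exact ⟨w, fun k => List.le_of_mem_argmax (List.mem_finRange k) h, rfl⟩

/-- The price of winning is the largest other bid, whatever the own bid. A truthful winner has at
least that value, and a truthful loser at most that value. -/
theorem secondPriceOutcome_truthful {v : SetValuation m} (hv : IsValuation v) (b : Fin n → ℝ)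
    {i : Fin n} (hb : b i = v Finset.univ) (x : ℝ) :
    v ((secondPriceOutcome m (Function.update b i x)).alloc i)
        - (secondPriceOutcome m (Function.update b i x)).pay i
      ≤ v ((secondPriceOutcome m b).alloc i) - (secondPriceOutcome m b).pay i := by
  obtain ⟨w, hw, h⟩ := secondPriceOutcome_eq (m := m) b i
  obtain ⟨w', -, h'⟩ := secondPriceOutcome_eq (m := m) (Function.update b i x) i
  have h0 := hv.nonneg Finset.univ
  rw [h, h']
  have hfold : (Finset.univ.erase i).fold max 0 (Function.update b i x)
      = (Finset.univ.erase i).fold max 0 b :=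
    Finset.fold_congr fun k hk => Function.update_of_ne (Finset.ne_of_mem_erase hk) _ _
  by_cases hiw : i = w
  · subst hiw
    have hle : (Finset.univ.erase i).fold max 0 b ≤ v Finset.univ :=
      Finset.fold_max_le _ |>.2 ⟨h0, fun k _ => hb ▸ hw k⟩
    by_cases hiw' : i = w'
    · subst hiw'
      simp [hfold]
    · simp [hiw', hv.1, hle]
  · by_cases hiw' : i = w'
    · subst hiw'
      have hle : v Finset.univ ≤ (Finset.univ.erase i).fold max 0 b :=
        Finset.le_fold_max _ |>.2 (Or.inr ⟨w, by simp [Ne.symm hiw], hb ▸ hw i⟩)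
      simp [hiw, hv.1, hfold, hle]
    · simp [hiw, hiw']

theorem welfare_secondPriceOutcome (hv : ∀ i, IsValuation (v i)) (i : Fin n) :
    v i Finset.univ
      ≤ welfare v (secondPriceOutcome m fun k => v k Finset.univ).alloc := by
  obtain ⟨w, hw, h⟩ := secondPriceOutcome_eq (m := m) (fun k => v k Finset.univ) i
  rw [h]
  refine (hw i).trans ?_
  have := Finset.single_le_sum
    (f := fun k => v k (if k = w then (Finset.univ : Finset (Fin m)) else ∅))
    (fun k _ => (hv k).nonneg _) (Finset.mem_univ w)
  simpa [welfare] using this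

end SecondPrice

/-! ### The loop over the chunks -/

section Loop

variable {n m : ℕ} (D : Fin n → SetValuation m → (Fin m → ℝ) → Finset (Fin m))
  (v : Fin n → SetValuation m)

/-- The price of all items in the auction of a chunk. -/
noncomputable def lowPrice (w : ℝ) (k : Fin (numChunks m)) : Fin m → ℝ :=
  fun _ => binPrice m w (k * chunkSize m + 1) / 2

/-- The prices after the auction of chunk `k` among the bidders in `U`, if the prices were `p`
before and bin `r` is used for pricing. -/
noncomputable def nextPrice (U : List (Fin n)) (w : ℝ) (r : Fin (chunkSize m))
    (k : Fin (numChunks m)) (p : Fin m → ℝ) : Fin m → ℝ :=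
  fun j => if j ∈ sold D v (lowPrice w k) U Finset.univ
    then binPrice m w (k * chunkSize m + (r + 1)) / 2 else p j

variable {D v} {c : MechCoins n m} {w : ℝ}

theorem run_chunkLoop_nil (p : Fin m → ℝ) :
    (chunkLoop c w [] p).run D v = atPrices p (fpa D v p c.finalBidders Finset.univ) := by
  simp only [chunkLoop, run_bind, run_pure, fpa]

theorem run_chunkLoop_cons (k : Fin (numChunks m)) (ks : List (Fin (numChunks m)))
    (p : Fin m → ℝ) :
    (chunkLoop c w (k :: ks) p).run D v =
      if c.halt k = 0 then
        atPrices (lowPrice w k) (fpa D v (lowPrice w k) c.uniformBidders Finset.univ)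
      else (chunkLoop c w ks (nextPrice D v c.uniformBidders w c.bin k p)).run D v := by
  rw [chunkLoop, run_bind]
  split_ifs <;> rfl

theorem run_mechAlg :
    (mechAlg c).run D v = if c.grand then secondPriceOutcome m fun i => v i Finset.univ
      else (chunkLoop c (greedyWelfare D v c.statBidders) (List.finRange (numChunks m))
        fun _ => 0).run D v := by
  unfold mechAlg
  split_ifs
  · exact run_secondPriceAuction
  · simp only [run_bind, greedyWelfare]

theorem roundUp_nonneg (x : ℝ) : 0 ≤ roundUp x := by
  unfold roundUp
  split_ifs <;> positivity

theorem binPrice_nonneg (w : ℝ) (k : ℕ) : 0 ≤ binPrice m w k := by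
  have := roundUp_nonneg w
  unfold binPrice
  positivity

theorem lowPrice_nonneg (w : ℝ) (k : Fin (numChunks m)) (j : Fin m) : 0 ≤ lowPrice w k j :=
  div_nonneg (binPrice_nonneg _ _) zero_le_two

theorem nextPrice_nonneg {U : List (Fin n)} {r : Fin (chunkSize m)} {k : Fin (numChunks m)}
    {p : Fin m → ℝ} (hp : ∀ j, 0 ≤ p j) (j : Fin m) : 0 ≤ nextPrice D v U w r k p j := by
  unfold nextPrice
  split_ifs
  exacts [div_nonneg (binPrice_nonneg _ _) zero_le_two, hp j]

theorem mem_statBidders {i : Fin n} : i ∈ c.statBidders ↔ c.role i = Role.stat := by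
  simp [MechCoins.statBidders]

theorem mem_uniformBidders {i : Fin n} : i ∈ c.uniformBidders ↔ c.role i = Role.uniform := by
  simp only [MechCoins.uniformBidders, List.mem_filter, List.mem_map, List.mem_finRange,
    true_and, decide_eq_true_eq, and_iff_right_iff_imp]
  exact fun _ => ⟨c.order.symm i, by simp⟩

theorem mem_finalBidders {i : Fin n} : i ∈ c.finalBidders ↔ c.role i = Role.final := by
  simp [MechCoins.finalBidders]

/-- The outcome for the bidders outside the two groups that buy items. -/
theorem chunkLoop_stat {i : Fin n} (hi : c.role i = Role.stat) (ks : List (Fin (numChunks m)))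
    (p : Fin m → ℝ) : ((chunkLoop c w ks p).run D v).alloc i = ∅ ∧
      ((chunkLoop c w ks p).run D v).pay i = 0 := by
  induction ks generalizing p with
  | nil =>
    have h := fpa_of_notMem (D := D) (v := v) (p := p)
      (mt mem_finalBidders.1 (by rw [hi]; decide)) Finset.univ
    rw [run_chunkLoop_nil]
    simp [atPrices, h]
  | cons k ks ih =>
    rw [run_chunkLoop_cons]
    have h := fpa_of_notMem (D := D) (v := v) (p := lowPrice w k)
      (mt mem_uniformBidders.1 (by rw [hi]; decide)) Finset.univ
    split_ifs
    · simp [atPrices, h]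
    · exact ih _

theorem chunkLoop_isAllocation (hD : ∀ i, IsDemandRule (D i)) (hv : ∀ i, IsValuation (v i))
    (ks : List (Fin (numChunks m))) {p : Fin m → ℝ} (hp : ∀ j, 0 ≤ p j) :
    IsAllocation ((chunkLoop c w ks p).run D v).alloc := by
  induction ks generalizing p with
  | nil =>
    rw [run_chunkLoop_nil]
    exact (fpa_disjoint hD hp hv _ _).2
  | cons k ks ih =>
    rw [run_chunkLoop_cons]
    split_ifs
    · exact (fpa_disjoint hD (lowPrice_nonneg _ _) hv _ _).2
    · exact ih (nextPrice_nonneg hp)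

/-- The induction carries two price vectors, because the report of a bidder in UNIFORM does alter
the prices for FINAL. They must agree only if the bidder is in FINAL; stopping is decided by the
coins. -/
theorem chunkLoop_truthful (hD : ∀ i, IsDemandRule (D i)) (hv : ∀ i, IsValuation (v i))
    {i : Fin n} {x : SetValuation m} (hx : IsValuation x)
    (ks : List (Fin (numChunks m))) {p p' : Fin m → ℝ} (hp : ∀ j, 0 ≤ p j)
    (hpp : c.role i = Role.final → p' = p) :
    v i (((chunkLoop c w ks p').run D (Function.update v i x)).alloc i)
        - ((chunkLoop c w ks p').run D (Function.update v i x)).pay i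
      ≤ v i (((chunkLoop c w ks p).run D v).alloc i) - ((chunkLoop c w ks p).run D v).pay i := by
  induction ks generalizing p p' with
  | nil =>
    rw [run_chunkLoop_nil, run_chunkLoop_nil]
    by_cases hi : c.role i = Role.final
    · rw [hpp hi]
      exact fpa_truthful hD hp hv _ _ i hx
    · have h : i ∉ c.finalBidders := mt mem_finalBidders.1 hi
      simp [atPrices, fpa_of_notMem h]
  | cons k ks ih =>
    rw [run_chunkLoop_cons, run_chunkLoop_cons]
    split_ifs
    · exact fpa_truthful hD (lowPrice_nonneg _ _) hv _ _ i hx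
    · refine ih (nextPrice_nonneg hp) fun hi => ?_
      have hU : i ∉ c.uniformBidders := mt mem_uniformBidders.1 (by rw [hi]; decide)
      have hfpa : fpa D (Function.update v i x) (lowPrice w k) c.uniformBidders Finset.univ
          = fpa D v (lowPrice w k) c.uniformBidders Finset.univ :=
        fpa_congr (fun k' hk' => Function.update_of_ne (ne_of_mem_of_not_mem hk' hU) _ _) _
      unfold nextPrice sold
      rw [hpp hi, hfpa]

theorem mechanism_universallyTruthful (hD : ∀ i, IsDemandRule (D i)) :
    (mechanism D).UniversallyTruthful {v | IsXOS v} := by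
  intro c _
  change MechCoins n m at c
  refine ⟨fun v hv => ?_, fun i v hv x hx => ?_⟩
  · have hv' : ∀ i, IsValuation (v i) := fun i => IsXOS.isValuation (hv i)
    change IsAllocation ((mechAlg c).run D v).alloc
    rw [run_mechAlg]
    split_ifs
    · exact secondPriceOutcome_isAllocation _
    · exact chunkLoop_isAllocation hD hv' _ fun _ => le_rfl
  · have hv' : ∀ i, IsValuation (v i) := fun i => IsXOS.isValuation (hv i)
    change v i (((mechAlg c).run D _).alloc i) - ((mechAlg c).run D _).pay i
      ≤ v i (((mechAlg c).run D v).alloc i) - ((mechAlg c).run D v).pay i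
    rw [run_mechAlg, run_mechAlg]
    split_ifs
    · have h : (fun k => Function.update v i x k Finset.univ)
          = Function.update (fun k => v k Finset.univ) i (x Finset.univ) := by
        ext k
        by_cases hk : k = i
        · subst hk
          simp
        · simp [hk]
      rw [h]
      exact secondPriceOutcome_truthful (hv' i) _ rfl _
    -- A report from STAT can change the estimate and hence all prices, but its author gets nothing.
    -- Any other report leaves the estimate alone.
    · by_cases hi : c.role i = Role.stat
      · rw [(chunkLoop_stat hi _ _).1, (chunkLoop_stat hi _ _).2, (chunkLoop_stat hi _ _).1,
          (chunkLoop_stat hi _ _).2]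
      · have hw : greedyWelfare D (Function.update v i x) c.statBidders
            = greedyWelfare D v c.statBidders := greedyWelfare_congr fun k hk =>
          Function.update_of_ne (by rintro rfl; exact hi (mem_statBidders.1 hk)) _ _
        rw [hw]
        exact chunkLoop_truthful hD hv' (IsXOS.isValuation hx) _ (fun _ => le_rfl) fun _ => rfl

end Loop

/-! ### Bins -/

section Bins

variable {m : ℕ}

theorem le_roundUp (w : ℝ) : w ≤ roundUp w := by
  unfold roundUp
  split_ifs with h
  · exact h
  · push Not at h
    calc w = (2 : ℝ) ^ Real.logb 2 w := (Real.rpow_logb two_pos (by norm_num) h).symm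
      _ ≤ (2 : ℝ) ^ ((⌈Real.logb 2 w⌉ : ℤ) : ℝ) :=
        Real.rpow_le_rpow_of_exponent_le one_le_two (Int.le_ceil _)
      _ = _ := Real.rpow_intCast _ _

theorem roundUp_le {w : ℝ} (h : 0 < w) : roundUp w ≤ 2 * w := by
  rw [roundUp, if_neg (not_le.2 h)]
  calc (2 : ℝ) ^ ⌈Real.logb 2 w⌉ = (2 : ℝ) ^ ((⌈Real.logb 2 w⌉ : ℤ) : ℝ) :=
        (Real.rpow_intCast _ _).symm
    _ ≤ (2 : ℝ) ^ (Real.logb 2 w + 1) :=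
        Real.rpow_le_rpow_of_exponent_le one_le_two (Int.ceil_lt_add_one _).le
    _ = 2 * w := by
        rw [Real.rpow_add two_pos, Real.rpow_logb two_pos (by norm_num) h, Real.rpow_one, mul_comm]

theorem binPrice_succ (w : ℝ) (k : ℕ) : binPrice m w (k + 1) = 2 * binPrice m w k := by
  unfold binPrice
  ring

theorem binPrice_mono (w : ℝ) : Monotone (binPrice m w) :=
  monotone_nat_of_le_succ fun k => by
    rw [binPrice_succ]
    linarith [binPrice_nonneg (m := m) w k]

/-- The value `q` belongs to bin `x.2 + 1` of chunk `x.1`. -/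
def InBin (w q : ℝ) (x : Fin (numChunks m) × Fin (chunkSize m)) : Prop :=
  binPrice m w (x.1 * chunkSize m + (x.2 + 1)) ≤ q ∧
    q < 2 * binPrice m w (x.1 * chunkSize m + (x.2 + 1))

theorem four_mul_logb_le : 4 * Real.logb 2 m ≤ numChunks m * chunkSize m := by
  have h : 4 * Real.logb 2 m / numChunks m ≤ chunkSize m :=
    (Nat.le_ceil _).trans (by exact_mod_cast le_max_right _ _)
  have h0 : (0 : ℝ) < numChunks m := by exact_mod_cast Nat.pos_of_ne_zero (NeZero.ne _)
  rwa [div_le_iff₀' h0] at h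

/-- With `y` the price of bin zero, choose `b` with `2 ^ b * y ≤ q < 2 ^ (b + 1) * y`. The lower
bound on `q` forces `b ≥ 1`. The upper bound gives `2 ^ b ≤ m ^ 3`, so `b` is at most three times
the binary logarithm of `m`, within the range covered by the chunks. -/
theorem exists_inBin (hm : 1 ≤ m) {w q : ℝ} (hw : 0 < w) (h1 : binPrice m w 1 ≤ q)
    (h2 : q ≤ m * w) : ∃ x : Fin (numChunks m) × Fin (chunkSize m), InBin w q x := by
  have hW := hw.trans_le (le_roundUp w)
  have hm' : (0 : ℝ) < m := by exact_mod_cast hm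
  set y : ℝ := roundUp w / (m : ℝ) ^ 2 with hy
  have hy0 : 0 < y := by positivity
  have hb : ∀ k, binPrice m w k = 2 ^ k * y := fun k => by rw [binPrice, hy, mul_div_assoc]
  have hx : 2 ≤ q / y := by
    rw [le_div_iff₀ hy0]
    simpa [hb] using h1
  obtain ⟨b, hb1, hb2⟩ := exists_nat_pow_near (by linarith : 1 ≤ q / y) one_lt_two
  have hb0 : 1 ≤ b := by
    by_contra h
    obtain rfl : b = 0 := by omega
    norm_num at hb2
    linarith
  have hbm : b - 1 < chunkSize m * numChunks m := by
    have h3 : (2 : ℝ) ^ b ≤ m ^ 3 := by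
      refine hb1.trans ?_
      rw [div_le_iff₀ hy0, hy]
      have : (m : ℝ) ^ 3 * (roundUp w / (m : ℝ) ^ 2) = m * roundUp w := by
        field_simp
      rw [this]
      exact h2.trans (by gcongr; exact le_roundUp w)
    have h4 : (b : ℝ) ≤ 3 * Real.logb 2 m := by
      have := Real.logb_le_logb_of_le one_lt_two (by positivity) h3
      rwa [Real.logb_pow, Real.logb_pow, Real.logb_self_eq_one one_lt_two, mul_one] at this
    have h5 := four_mul_logb_le (m := m)
    have h6 : 0 ≤ Real.logb 2 m := Real.logb_nonneg one_lt_two (by exact_mod_cast hm)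
    have h7 : (b : ℝ) ≤ (chunkSize m * numChunks m : ℕ) := by
      push_cast
      linarith
    have := Nat.cast_le.1 h7
    omega
  -- Bins are numbered from one, so it is `b - 1` that is divided with remainder.
  refine ⟨⟨⟨(b - 1) / chunkSize m, Nat.div_lt_of_lt_mul hbm⟩,
    ⟨(b - 1) % chunkSize m, Nat.mod_lt _ (Nat.pos_of_ne_zero (NeZero.ne _))⟩⟩, ?_⟩
  have hidx : (b - 1) / chunkSize m * chunkSize m + ((b - 1) % chunkSize m + 1) = b := by
    have := Nat.div_add_mod' (b - 1) (chunkSize m)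
    omega
  rw [InBin, hidx, ← binPrice_succ, hb, hb]
  exact ⟨(le_div_iff₀ hy0).1 hb1, (div_lt_iff₀ hy0).1 hb2⟩

variable {w q : ℝ} {x : Fin (numChunks m) × Fin (chunkSize m)}

theorem InBin.nonneg (h : InBin w q x) : 0 ≤ q := (binPrice_nonneg _ _).trans h.1

/-- At the price of its own chunk, half the lowest bin, an item leaves at least half of `q` as
profit. -/
theorem InBin.lowPrice_le (h : InBin w q x) (j : Fin m) : lowPrice w x.1 j ≤ q / 2 := by
  have := binPrice_mono (m := m) w (show x.1 * chunkSize m + 1 ≤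
    x.1 * chunkSize m + (x.2 + 1 : ℕ) by omega)
  have := h.1
  unfold lowPrice
  linarith

/-- A later chunk starts at least one bin above that of `q`, where the bin price exceeds `q`; so a
sale there earns at least `q / 2`. -/
theorem InBin.le_lowPrice (h : InBin w q x) {k : Fin (numChunks m)} (hk : x.1 < k) (j : Fin m) :
    q / 2 ≤ lowPrice w k j := by
  have h1 : (x.1 : ℕ) * chunkSize m + (x.2 + 1) + 1 ≤ k * chunkSize m + 1 := by
    have h3 : ((x.1 : ℕ) + 1) * chunkSize m ≤ k * chunkSize m := Nat.mul_le_mul_right _ hk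
    have := x.2.isLt
    nlinarith
  have := binPrice_mono (m := m) w h1
  rw [binPrice_succ] at this
  have := h.2
  unfold lowPrice
  linarith

end Bins

/-! ### The welfare of the auctions in the loop -/

section LoopWelfare

variable {n m : ℕ} {D : Fin n → SetValuation m → (Fin m → ℝ) → Finset (Fin m)}
  {v : Fin n → SetValuation m}

/-- A lower bound for the welfare of a fixed price auction at prices that are neither too low nor
too high. -/
theorem sum_le_welfare_fpa (hD : ∀ i, IsDemandRule (D i)) {p : Fin m → ℝ} (hp : ∀ j, 0 ≤ p j)
    (hv : ∀ i, IsValuation (v i)) {l : List (Fin n)} (hl : l.Nodup) {q : Fin m → ℝ}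
    {G : Bundles n m} (hG : IsAllocation G) (hq : ∀ i, ∀ S ⊆ G i, ∑ j ∈ S, q j ≤ v i S)
    {h : Fin m → ℝ} (h1 : ∀ i, ∀ j ∈ G i, h j ≤ p j) (h2 : ∀ i, ∀ j ∈ G i, h j ≤ q j - p j) :
    ∑ i with i ∈ l, ∑ j ∈ G i, h j ≤ welfare v (fpa D v p l Finset.univ) := by
  refine le_trans ?_ (le_welfare_fpa hD hp hv Finset.univ hq)
  -- An item that its bidder could have bought counts through the profit `q j - p j`; one that was
  -- gone on arrival was sold and counts through the revenue `p j`.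
  have hsplit : ∑ i with i ∈ l, ∑ j ∈ G i, h j =
      (∑ i with i ∈ l, ∑ j ∈ G i ∩ availableAt D v p l Finset.univ i, h j) +
        ∑ i with i ∈ l, ∑ j ∈ G i \ availableAt D v p l Finset.univ i, h j := by
    rw [← Finset.sum_add_distrib]
    exact Finset.sum_congr rfl fun i _ => (Finset.sum_inter_add_sum_sdiff _ _ _).symm
  rw [hsplit]
  refine add_le_add (Finset.sum_le_sum fun i _ => Finset.sum_le_sum fun j hj =>
    h2 i j (Finset.mem_inter.1 hj).1) ?_
  calc ∑ i with i ∈ l, ∑ j ∈ G i \ availableAt D v p l Finset.univ i, h j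
      ≤ ∑ i with i ∈ l, ∑ j ∈ G i \ availableAt D v p l Finset.univ i, p j :=
        Finset.sum_le_sum fun i _ => Finset.sum_le_sum fun j hj =>
          h1 i j (Finset.mem_sdiff.1 hj).1
    _ = ∑ j ∈ (Finset.univ.filter (· ∈ l)).biUnion
          fun i => G i \ availableAt D v p l Finset.univ i, p j :=
        (Finset.sum_biUnion fun i _ i' _ hii' => (hG i i' hii').mono Finset.sdiff_subset
          Finset.sdiff_subset).symm
    _ ≤ ∑ j ∈ sold D v p l Finset.univ, p j := by
        refine Finset.sum_le_sum_of_subset_of_nonneg (fun j hj => ?_) fun j _ _ => hp j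
        obtain ⟨i, -, hi⟩ := Finset.mem_biUnion.1 hj
        by_contra hns
        exact (Finset.mem_sdiff.1 hi).2 (sdiff_sold_subset_availableAt hl _ i
          (Finset.mem_sdiff.2 ⟨Finset.mem_univ j, hns⟩))

variable (D v) in
/-- The items sold in the auction of chunk `k`. -/
noncomputable def soldIn (U : List (Fin n)) (w : ℝ) (k : Fin (numChunks m)) : Finset (Fin m) :=
  sold D v (lowPrice w k) U Finset.univ

variable (D v) in
/-- The items available to bidder `i` in the auction of chunk `k`. -/
noncomputable def availableIn (U : List (Fin n)) (w : ℝ) (k : Fin (numChunks m)) (i : Fin n) :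
    Finset (Fin m) :=
  availableAt D v (lowPrice w k) U Finset.univ i

variable (D v) in
/-- The prices after the auctions of the chunks in the list `ks`. -/
noncomputable def pricesAfter (U : List (Fin n)) (w : ℝ) (r : Fin (chunkSize m))
    (ks : List (Fin (numChunks m))) (p : Fin m → ℝ) : Fin m → ℝ :=
  ks.foldl (fun p k => nextPrice D v U w r k p) p

variable (D v) in
/-- The welfare of the auction of chunk `k`. -/
noncomputable def chunkWelfare (U : List (Fin n)) (w : ℝ) (k : Fin (numChunks m)) : ℝ :=
  welfare v (fpa D v (lowPrice w k) U Finset.univ)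

variable (D v) in
/-- The welfare of the final auction. -/
noncomputable def finalWelfare (U F : List (Fin n)) (w : ℝ) (r : Fin (chunkSize m)) : ℝ :=
  welfare v (fpa D v (pricesAfter D v U w r (List.finRange (numChunks m)) fun _ => 0) F
    Finset.univ)

variable {U F : List (Fin n)} {w : ℝ} {r : Fin (chunkSize m)}

theorem pricesAfter_nonneg (ks : List (Fin (numChunks m))) {p : Fin m → ℝ} (hp : ∀ j, 0 ≤ p j)
    (j : Fin m) : 0 ≤ pricesAfter D v U w r ks p j := by
  induction ks generalizing p with
  | nil => exact hp j
  | cons k ks ih => exact ih (nextPrice_nonneg hp)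

theorem pricesAfter_of_unsold {ks : List (Fin (numChunks m))} (p : Fin m → ℝ) {j : Fin m}
    (h : ∀ k ∈ ks, j ∉ soldIn D v U w k) : pricesAfter D v U w r ks p j = p j := by
  induction ks generalizing p with
  | nil => rfl
  | cons k ks ih =>
    refine (ih _ fun k' hk' => h k' (List.mem_cons_of_mem _ hk')).trans ?_
    exact if_neg (h k List.mem_cons_self)

/-- Each sale overwrites the price, so the last one decides. -/
theorem pricesAfter_of_last_sold {ks : List (Fin (numChunks m))} (hks : ks.Pairwise (· < ·))
    (p : Fin m → ℝ) {j : Fin m} {k : Fin (numChunks m)} (hk : k ∈ ks)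
    (hj : j ∈ soldIn D v U w k) (h : ∀ k', k < k' → j ∉ soldIn D v U w k') :
    pricesAfter D v U w r ks p j = binPrice m w (k * chunkSize m + (r + 1)) / 2 := by
  induction ks generalizing p with
  | nil => simp at hk
  | cons a ks ih =>
    rw [List.pairwise_cons] at hks
    rcases List.mem_cons.1 hk with rfl | hk
    · exact (pricesAfter_of_unsold _ fun k' hk' => h k' (hks.1 k' hk')).trans (if_pos hj)
    · exact ih hks.2 _ hk

variable (hD : ∀ i, IsDemandRule (D i)) (hv : ∀ i, IsValuation (v i)) {q : Fin m → ℝ}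
  {G : Bundles n m} (hq : ∀ i, ∀ S ⊆ G i, ∑ j ∈ S, q j ≤ v i S)
  {x : Fin m → Fin (numChunks m) × Fin (chunkSize m)} (hx : ∀ i, ∀ j ∈ G i, InBin w (q j) (x j))

include hD hv hq hx

/-- In the auction of chunk `k` the bundle `G i` is cut down to its items of that chunk, on each of
which bidder `i` could have made profit `q j / 2`. Every item belongs to one chunk, so nothing is
counted twice. -/
theorem available_le_chunkWelfare :
    ∑ i with i ∈ U, ∑ j ∈ G i with j ∈ availableIn D v U w (x j).1 i, q j / 2
      ≤ ∑ k, chunkWelfare D v U w k := by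
  calc ∑ i with i ∈ U, ∑ j ∈ G i with j ∈ availableIn D v U w (x j).1 i, q j / 2
      = ∑ k, ∑ i with i ∈ U,
          ∑ j ∈ {j ∈ G i | (x j).1 = k} ∩ availableIn D v U w k i, q j / 2 := by
        rw [Finset.sum_comm]
        refine Finset.sum_congr rfl fun i _ => ?_
        rw [← Finset.sum_fiberwise _ fun j => (x j).1]
        refine Finset.sum_congr rfl fun k _ => Finset.sum_congr ?_ fun _ _ => rfl
        ext j
        simp only [Finset.mem_filter, Finset.mem_inter]
        constructor
        · rintro ⟨⟨a, b⟩, rfl⟩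
          exact ⟨⟨a, rfl⟩, b⟩
        · rintro ⟨⟨a, rfl⟩, b⟩
          exact ⟨⟨a, b⟩, rfl⟩
    _ ≤ ∑ k, chunkWelfare D v U w k := by
        refine Finset.sum_le_sum fun k _ => ?_
        refine le_trans ?_ (le_welfare_fpa hD (lowPrice_nonneg w k) hv Finset.univ
          (G := fun i => {j ∈ G i | (x j).1 = k})
          fun i S hS => hq i S (hS.trans (Finset.filter_subset _ _)))
        refine le_trans ?_ (le_add_of_nonneg_right
          (Finset.sum_nonneg fun j _ => lowPrice_nonneg w k j))
        refine Finset.sum_le_sum fun i _ => Finset.sum_le_sum fun j hj => ?_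
        obtain ⟨h1, rfl⟩ := Finset.mem_filter.1 (Finset.mem_inter.1 hj).1
        linarith [(hx i j h1).lowPrice_le j]

omit hq in
open Classical in
-- One later sale brings revenue at least `q j / 2`, and the welfare of an auction is at least its
-- revenue.
theorem soldLater_le_chunkWelfare (hG : IsAllocation G) :
    ∑ i, ∑ j ∈ G i with ∃ k, (x j).1 < k ∧ j ∈ soldIn D v U w k, q j / 2
      ≤ ∑ k, chunkWelfare D v U w k := by
  calc ∑ i, ∑ j ∈ G i with ∃ k, (x j).1 < k ∧ j ∈ soldIn D v U w k, q j / 2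
      = ∑ j ∈ Finset.univ.biUnion fun i =>
          {j ∈ G i | ∃ k, (x j).1 < k ∧ j ∈ soldIn D v U w k}, q j / 2 :=
        (Finset.sum_biUnion fun i _ i' _ hii' => (hG i i' hii').mono (Finset.filter_subset _ _)
          (Finset.filter_subset _ _)).symm
    _ ≤ ∑ j ∈ Finset.univ.biUnion fun i =>
          {j ∈ G i | ∃ k, (x j).1 < k ∧ j ∈ soldIn D v U w k},
          ∑ k, if j ∈ soldIn D v U w k then lowPrice w k j else 0 := by
        refine Finset.sum_le_sum fun j hj => ?_
        obtain ⟨i, -, hi⟩ := Finset.mem_biUnion.1 hj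
        obtain ⟨hji, k, hk, hjk⟩ := Finset.mem_filter.1 hi
        refine ((hx i j hji).le_lowPrice hk j).trans ?_
        have := Finset.single_le_sum
          (f := fun k => if j ∈ soldIn D v U w k then lowPrice w k j else 0)
          (fun k _ => by split_ifs; exacts [lowPrice_nonneg w k j, le_rfl]) (Finset.mem_univ k)
        rwa [if_pos hjk] at this
    _ ≤ ∑ j, ∑ k, if j ∈ soldIn D v U w k then lowPrice w k j else 0 :=
        Finset.sum_le_sum_of_subset_of_nonneg (Finset.subset_univ _) fun j _ _ =>
          Finset.sum_nonneg fun k _ => by split_ifs; exacts [lowPrice_nonneg w k j, le_rfl]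
    _ = ∑ k, ∑ j ∈ soldIn D v U w k, lowPrice w k j := by
        rw [Finset.sum_comm]
        simp
    _ ≤ ∑ k, chunkWelfare D v U w k := by
        refine Finset.sum_le_sum fun k _ => ?_
        -- With empty target bundles only the revenue term is left.
        have := le_welfare_fpa hD (lowPrice_nonneg w k) hv (l := U) Finset.univ
          (G := fun _ => ∅) (q := q) fun i S hS => by
            rw [Finset.subset_empty.1 hS, Finset.sum_empty]
            exact (hv i).nonneg _
        simpa [soldIn, chunkWelfare] using this

open Classical in
-- The items are grouped by their bin within the chunk. If `r` is that bin, the final price is half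
-- the bin price, so that both `p j` and `q j - p j` are at least `q j / 4`, as `sum_le_welfare_fpa`
-- requires.
theorem lastSold_le_finalWelfare (hG : IsAllocation G) (hF : F.Nodup) :
    ∑ i with i ∈ F, ∑ j ∈ G i with j ∈ soldIn D v U w (x j).1 ∧
        ∀ k, (x j).1 < k → j ∉ soldIn D v U w k, q j / 4
      ≤ ∑ r, finalWelfare D v U F w r := by
  calc ∑ i with i ∈ F, ∑ j ∈ G i with j ∈ soldIn D v U w (x j).1 ∧
        ∀ k, (x j).1 < k → j ∉ soldIn D v U w k, q j / 4
      = ∑ r, ∑ i with i ∈ F, ∑ j ∈ {j ∈ G i | j ∈ soldIn D v U w (x j).1 ∧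
          ∀ k, (x j).1 < k → j ∉ soldIn D v U w k} with (x j).2 = r, q j / 4 := by
        rw [Finset.sum_comm]
        exact Finset.sum_congr rfl fun i _ => (Finset.sum_fiberwise _ (fun j => (x j).2) _).symm
    _ ≤ ∑ r, finalWelfare D v U F w r := by
        refine Finset.sum_le_sum fun r _ => ?_
        have hsub : ∀ i, ({j ∈ {j ∈ G i | j ∈ soldIn D v U w (x j).1 ∧
            ∀ k, (x j).1 < k → j ∉ soldIn D v U w k} | (x j).2 = r} : Finset _) ⊆ G i :=
          fun i => (Finset.filter_subset _ _).trans (Finset.filter_subset _ _)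
        have hprice : ∀ i, ∀ j ∈ ({j ∈ {j ∈ G i | j ∈ soldIn D v U w (x j).1 ∧
            ∀ k, (x j).1 < k → j ∉ soldIn D v U w k} | (x j).2 = r} : Finset _),
            pricesAfter D v U w r (List.finRange (numChunks m)) (fun _ => 0) j
              = binPrice m w ((x j).1 * chunkSize m + ((x j).2 + 1)) / 2 := by
          intro i j hj
          simp only [Finset.mem_filter] at hj
          rw [hj.2]
          exact pricesAfter_of_last_sold (List.pairwise_lt_finRange _) _ (List.mem_finRange _)
            hj.1.2.1 hj.1.2.2
        refine sum_le_welfare_fpa hD (pricesAfter_nonneg _ fun _ => le_rfl) hv hF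
          (fun i i' h => (hG i i' h).mono (hsub i) (hsub i'))
          (fun i S hS => hq i S (hS.trans (hsub i))) (fun i j hj => ?_) fun i j hj => ?_
        all_goals
          have hb := hx i j (hsub i hj)
          rw [hprice i j hj]
          linarith [hb.1, hb.2, hb.nonneg]

end LoopWelfare

/-! ### Averaging over the groups -/

section Roles

variable {n m : ℕ}

/-- The bidders in `uniform`, ordered according to `π`. -/
def uniformList (ρ : Fin n → Role) (π : Equiv.Perm (Fin n)) : List (Fin n) :=
  ((List.finRange n).map π).filter fun i => ρ i = Role.uniform

def statList (ρ : Fin n → Role) : List (Fin n) :=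
  (List.finRange n).filter fun i => ρ i = Role.stat

def finalList (ρ : Fin n → Role) : List (Fin n) :=
  (List.finRange n).filter fun i => ρ i = Role.final

theorem mem_uniformList {ρ : Fin n → Role} {π : Equiv.Perm (Fin n)} {i : Fin n} :
    i ∈ uniformList ρ π ↔ ρ i = Role.uniform := by
  simp only [uniformList, List.mem_filter, List.mem_map, List.mem_finRange,
    true_and, decide_eq_true_eq, and_iff_right_iff_imp]
  exact fun _ => ⟨π.symm i, by simp⟩

theorem nodup_uniformList (ρ : Fin n → Role) (π : Equiv.Perm (Fin n)) :
    (uniformList ρ π).Nodup :=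
  ((List.nodup_finRange n).map π.injective).filter _

theorem mem_finalList {ρ : Fin n → Role} {i : Fin n} : i ∈ finalList ρ ↔ ρ i = Role.final := by
  simp [finalList]

theorem mem_statList {ρ : Fin n → Role} {i : Fin n} : i ∈ statList ρ ↔ ρ i = Role.stat := by
  simp [statList]

variable {ρ : Fin n → Role} {i : Fin n}

theorem uniformList_update (hi : ρ i = Role.final) (π : Equiv.Perm (Fin n)) :
    uniformList ρ π =
      (uniformList (Function.update ρ i Role.uniform) π).filter fun k => k ≠ i := by
  rw [uniformList, uniformList, List.filter_filter]
  refine List.filter_congr fun k _ => ?_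
  by_cases hk : k = i
  · subst hk
    simp [hi]
  · simp [hk]

theorem statList_update (hi : ρ i = Role.final) :
    statList (Function.update ρ i Role.uniform) = statList ρ := by
  refine List.filter_congr fun k _ => ?_
  by_cases hk : k = i
  · subst hk
    simp [hi]
  · simp [hk]

/-- Two given bidders are in two given groups with probability at least `1 / 9`. -/
theorem card_role_le (i i' : Fin n) (hii' : i' ≠ i) (a b : Role) :
    (Fintype.card (Fin n → Role) : ℝ) ≤
      9 * ({ρ : Fin n → Role | ρ i = a ∧ ρ i' = b} : Finset (Fin n → Role)).card := by
  have h : (Finset.univ : Finset (Fin n → Role)).card ≤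
      (({ρ : Fin n → Role | ρ i = a ∧ ρ i' = b} : Finset (Fin n → Role)) ×ˢ
        (Finset.univ : Finset (Role × Role))).card := by
    -- Force the two groups and remember the old ones.
    refine Finset.card_le_card_of_injOn
      (fun ρ => (Function.update (Function.update ρ i a) i' b, ρ i, ρ i')) ?_ ?_
    · intro ρ _
      simp [hii'.symm]
    · intro ρ _ ρ' _ h
      simp only [Prod.mk.injEq] at h
      obtain ⟨h1, h2, h3⟩ := h
      ext k
      by_cases hk : k = i
      · rw [hk, h2]
      · by_cases hk' : k = i'
        · rw [hk', h3]
        · simpa [hk, hk'] using congrFun h1 k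
  rw [Finset.card_product] at h
  have h9 : (Finset.univ : Finset (Role × Role)).card = 9 := rfl
  rw [h9, Finset.card_univ] at h
  rw [mul_comm]
  exact_mod_cast h

end Roles

/-! ### The three ways in which an item is paid for -/

section Gain

open Classical

variable {n m : ℕ} (D : Fin n → SetValuation m → (Fin m → ℝ) → Finset (Fin m))
  (v : Fin n → SetValuation m) (q : Fin m → ℝ)

/-- The chunk and the bin of the value `q`. -/
noncomputable def binOf (w q : ℝ) : Fin (numChunks m) × Fin (chunkSize m) :=
  -- The default value is harmless, since the gains below vanish without a bin.
  if h : ∃ x, InBin w q x then h.choose else 0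

theorem inBin_binOf {w q : ℝ} (h : ∃ x : Fin (numChunks m) × Fin (chunkSize m), InBin w q x) :
    InBin w q (binOf (m := m) w q) := by
  rw [binOf, dif_pos h]
  exact h.choose_spec

/-- The value `q` belongs to some bin. -/
def HasBin (m : ℕ) (w q : ℝ) : Prop :=
  ∃ x : Fin (numChunks m) × Fin (chunkSize m), InBin w q x

/-- The value of item `j` if bidder `i` could have bought it in the auction of its chunk. -/
noncomputable def gainUniform (w : ℝ) (ρ : Fin n → Role) (π : Equiv.Perm (Fin n)) (i : Fin n)
    (j : Fin m) : ℝ :=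
  if i ∈ uniformList ρ π ∧ HasBin m w (q j) ∧
    j ∈ availableIn D v (uniformList ρ π) w (binOf w (q j)).1 i then q j else 0

/-- The value of item `j` if it is sold in the auction of a later chunk. -/
noncomputable def gainLater (w : ℝ) (ρ : Fin n → Role) (π : Equiv.Perm (Fin n)) (j : Fin m) : ℝ :=
  if HasBin m w (q j) ∧ ∃ k, (binOf w (q j)).1 < k ∧ j ∈ soldIn D v (uniformList ρ π) w k
    then q j else 0

/-- The value of item `j` if the auction of its chunk is the last one in which it is sold, and if
bidder `i` takes part in the final auction. -/
noncomputable def gainFinal (w : ℝ) (ρ : Fin n → Role) (π : Equiv.Perm (Fin n)) (i : Fin n)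
    (j : Fin m) : ℝ :=
  if i ∈ finalList ρ ∧ HasBin m w (q j) ∧
    j ∈ soldIn D v (uniformList ρ π) w (binOf w (q j)).1 ∧
      ∀ k, (binOf w (q j)).1 < k → j ∉ soldIn D v (uniformList ρ π) w k then q j else 0

variable {D v q}

/-- The cases are: unsold in the auction of its chunk, sold in a later one, or sold there for the
last time. Only the first involves the changed grouping. -/
theorem le_gain_of_final (hq : ∀ j, 0 ≤ q j) {w : ℝ} {ρ : Fin n → Role} {i : Fin n}
    (hi : ρ i = Role.final) (π : Equiv.Perm (Fin n)) {j : Fin m} (hj : HasBin m w (q j)) :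
    q j ≤ gainUniform D v q w (Function.update ρ i Role.uniform) π i j +
      gainLater D v q w ρ π j + gainFinal D v q w ρ π i j := by
  have h1 : 0 ≤ gainUniform D v q w (Function.update ρ i Role.uniform) π i j := by
    unfold gainUniform; split_ifs; exacts [hq j, le_rfl]
  have h2 : 0 ≤ gainLater D v q w ρ π j := by
    unfold gainLater; split_ifs; exacts [hq j, le_rfl]
  have h3 : 0 ≤ gainFinal D v q w ρ π i j := by
    unfold gainFinal; split_ifs; exacts [hq j, le_rfl]
  have hU : i ∉ uniformList ρ π := fun h => by
    rw [mem_uniformList, hi] at h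
    cases h
  by_cases hs : j ∈ soldIn D v (uniformList ρ π) w (binOf w (q j)).1
  · by_cases hl : ∃ k, (binOf w (q j)).1 < k ∧ j ∈ soldIn D v (uniformList ρ π) w k
    · have : gainLater D v q w ρ π j = q j := if_pos ⟨hj, hl⟩
      linarith
    · have : gainFinal D v q w ρ π i j = q j :=
        if_pos ⟨mem_finalList.2 hi, hj, hs, by push Not at hl; exact hl⟩
      linarith
  · have : gainUniform D v q w (Function.update ρ i Role.uniform) π i j = q j := by
      refine if_pos ⟨mem_uniformList.2 (by simp), hj, ?_⟩
      -- Dropping `i` from the enlarged list gives back the original auction, at whose end `j` is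
      -- still unsold.
      apply availableAt_filter_subset
      rw [← uniformList_update hi, availableAt_of_notMem (nodup_uniformList ρ π) _ hU]
      exact Finset.mem_sdiff.2 ⟨Finset.mem_univ j, hs⟩
    linarith

/-- The bundles of `O` without the bidder `t` and without the items whose value has no bin. -/
noncomputable def restrictBundles (q : Fin m → ℝ) (O : Bundles n m) (t : Fin n) (w : ℝ) :
    Bundles n m :=
  fun i => if i = t then ∅ else {j ∈ O i | HasBin m w (q j)}

theorem restrictBundles_subset (O : Bundles n m) (t : Fin n) (w : ℝ) (i : Fin n) :
    restrictBundles q O t w i ⊆ O i := by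
  unfold restrictBundles
  split_ifs
  exacts [Finset.empty_subset _, Finset.filter_subset _ _]

theorem sum_restrictBundles (O : Bundles n m) (t : Fin n) (w : ℝ) (P : Fin n → Prop)
    [DecidablePred P] (Q : Fin n → Fin m → Prop) [∀ i, DecidablePred (Q i)] (f : Fin m → ℝ) :
    ∑ i with P i, ∑ j ∈ restrictBundles q O t w i with Q i j, f j =
      ∑ i ∈ Finset.univ.erase t, ∑ j ∈ O i,
        if P i ∧ HasBin m w (q j) ∧ Q i j then f j else 0 := by
  rw [Finset.sum_filter, ← Finset.add_sum_erase _ _ (Finset.mem_univ t)]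
  have h0 : (if P t then ∑ j ∈ restrictBundles q O t w t with Q t j, f j else 0) = 0 := by
    simp [restrictBundles]
  rw [h0, zero_add]
  refine Finset.sum_congr rfl fun i hi => ?_
  rw [restrictBundles, if_neg (Finset.ne_of_mem_erase hi), Finset.filter_filter,
    Finset.sum_filter]
  by_cases hP : P i <;> simp [hP]

/-- The first two gains each cost twice the chunk welfare, from `q j / 2`; the third costs four
times the final welfare, from `q j / 4`. This gives the factor 4. -/
theorem sum_gain_le (hD : ∀ i, IsDemandRule (D i)) (hv : ∀ i, IsValuation (v i))
    {O : Bundles n m} (hO : IsAllocation O) (hq : ∀ i, ∀ S ⊆ O i, ∑ j ∈ S, q j ≤ v i S)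
    (t : Fin n) (w : ℝ) (ρ : Fin n → Role) (π : Equiv.Perm (Fin n)) :
    ∑ i ∈ Finset.univ.erase t, ∑ j ∈ O i, (gainUniform D v q w ρ π i j + gainLater D v q w ρ π j +
        gainFinal D v q w ρ π i j) ≤
      4 * (∑ k, chunkWelfare D v (uniformList ρ π) w k +
        ∑ r, finalWelfare D v (uniformList ρ π) (finalList ρ) w r) := by
  have hsub := restrictBundles_subset (q := q) O t w
  have hq' : ∀ i, ∀ S ⊆ restrictBundles q O t w i, ∑ j ∈ S, q j ≤ v i S :=
    fun i S hS => hq i S (hS.trans (hsub i))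
  have hG : IsAllocation (restrictBundles q O t w) :=
    fun i i' h => (hO i i' h).mono (hsub i) (hsub i')
  have hx : ∀ i, ∀ j ∈ restrictBundles q O t w i, InBin w (q j) (binOf (m := m) w (q j)) := by
    intro i j hj
    unfold restrictBundles at hj
    split_ifs at hj
    · simp at hj
    · exact inBin_binOf (Finset.mem_filter.1 hj).2
  have h1 := available_le_chunkWelfare (U := uniformList ρ π) hD hv hq' hx
  have h2 := soldLater_le_chunkWelfare (U := uniformList ρ π) hD hv hx hG
  have h3 := lastSold_le_finalWelfare (U := uniformList ρ π) (F := finalList ρ) hD hv hq' hx hG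
    ((List.nodup_finRange n).filter _)
  rw [sum_restrictBundles O t w (fun i => i ∈ uniformList ρ π)
    (fun i j => j ∈ availableIn D v (uniformList ρ π) w (binOf w (q j)).1 i) fun j => q j / 2] at h1
  rw [← Finset.filter_true_of_mem (s := Finset.univ) (p := fun _ : Fin n => True) (by simp),
    sum_restrictBundles O t w (fun _ => True) (fun _ j => ∃ k, (binOf w (q j)).1 < k ∧
      j ∈ soldIn D v (uniformList ρ π) w k) fun j => q j / 2] at h2
  rw [sum_restrictBundles O t w (fun i => i ∈ finalList ρ)
    (fun _ j => j ∈ soldIn D v (uniformList ρ π) w (binOf w (q j)).1 ∧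
      ∀ k, (binOf w (q j)).1 < k → j ∉ soldIn D v (uniformList ρ π) w k) fun j => q j / 4] at h3
  have e1 : ∑ i ∈ Finset.univ.erase t, ∑ j ∈ O i, gainUniform D v q w ρ π i j ≤
      2 * ∑ k, chunkWelfare D v (uniformList ρ π) w k := by
    refine le_trans (le_of_eq ?_) (mul_le_mul_of_nonneg_left h1 zero_le_two)
    rw [Finset.mul_sum]
    refine Finset.sum_congr rfl fun i _ => ?_
    rw [Finset.mul_sum]
    refine Finset.sum_congr rfl fun j _ => ?_
    rw [gainUniform]
    split_ifs <;> ring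
  have e2 : ∑ i ∈ Finset.univ.erase t, ∑ j ∈ O i, gainLater D v q w ρ π j ≤
      2 * ∑ k, chunkWelfare D v (uniformList ρ π) w k := by
    refine le_trans (le_of_eq ?_) (mul_le_mul_of_nonneg_left h2 zero_le_two)
    rw [Finset.mul_sum]
    refine Finset.sum_congr rfl fun i _ => ?_
    rw [Finset.mul_sum]
    refine Finset.sum_congr rfl fun j _ => ?_
    simp only [gainLater, true_and]
    split_ifs <;> ring
  have e3 : ∑ i ∈ Finset.univ.erase t, ∑ j ∈ O i, gainFinal D v q w ρ π i j ≤
      4 * ∑ r, finalWelfare D v (uniformList ρ π) (finalList ρ) w r := by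
    refine le_trans (le_of_eq ?_) (mul_le_mul_of_nonneg_left h3 zero_le_four)
    rw [Finset.mul_sum]
    refine Finset.sum_congr rfl fun i _ => ?_
    rw [Finset.mul_sum]
    refine Finset.sum_congr rfl fun j _ => ?_
    rw [gainFinal]
    split_ifs <;> ring
  simp only [Finset.sum_add_distrib]
  linarith

variable (D v) in
/-- The welfare estimate as a function of the groups. -/
noncomputable def estimate (ρ : Fin n → Role) : ℝ := greedyWelfare D v (statList ρ)

theorem gain_nonneg (hq : ∀ j, 0 ≤ q j) (w : ℝ) (ρ : Fin n → Role) (π : Equiv.Perm (Fin n))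
    (i : Fin n) (j : Fin m) : 0 ≤ gainUniform D v q w ρ π i j ∧ 0 ≤ gainLater D v q w ρ π j ∧
      0 ≤ gainFinal D v q w ρ π i j := by
  unfold gainUniform gainLater gainFinal
  refine ⟨?_, ?_, ?_⟩ <;> split_ifs <;> first | exact hq j | exact le_rfl

/-- The expected gain from item `j`, by moving bidder `i` from `final` to `uniform`. -/
theorem le_sum_gain (hq : ∀ j, 0 ≤ q j) {t i : Fin n} (hit : i ≠ t) (π : Equiv.Perm (Fin n))
    {j : Fin m} {ε : ℝ} (hε0 : 0 ≤ ε) (hε : ∀ ρ : Fin n → Role, ρ t = Role.stat →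
      HasBin m (estimate D v ρ) (q j) ∨ q j ≤ ε) :
    (q j - ε) * Fintype.card (Fin n → Role) ≤
      9 * ∑ ρ : Fin n → Role with ρ t = Role.stat, (gainUniform D v q (estimate D v ρ) ρ π i j +
        gainLater D v q (estimate D v ρ) ρ π j + gainFinal D v q (estimate D v ρ) ρ π i j) := by
  set R : Finset (Fin n → Role) := {ρ | ρ t = Role.stat} with hR
  set R' : Finset (Fin n → Role) := {ρ | ρ t = Role.stat ∧ ρ i = Role.final} with hR'
  have hsub : R' ⊆ R := fun ρ h => by
    simp only [hR', hR, Finset.mem_filter, Finset.mem_univ, true_and] at h ⊢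
    exact h.1
  have hupd : ∀ ρ ∈ R', estimate D v (Function.update ρ i Role.uniform) = estimate D v ρ := by
    intro ρ h
    rw [estimate, statList_update (Finset.mem_filter.1 h).2.2, estimate]
  have hinj : Set.InjOn (fun ρ : Fin n → Role => Function.update ρ i Role.uniform) R' := by
    intro ρ h ρ' h' heq
    have h1 := (Finset.mem_filter.1 h).2.2
    have h2 := (Finset.mem_filter.1 h').2.2
    ext k
    by_cases hk : k = i
    · rw [hk, h1, h2]
    · simpa [hk] using congrFun heq k
  -- Reindexing along the injective move charges the gain to the grouping after the move, where `t`
  -- is still in STAT.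
  have hU : ∑ ρ ∈ R', gainUniform D v q (estimate D v ρ) (Function.update ρ i Role.uniform) π i j
      ≤ ∑ ρ ∈ R, gainUniform D v q (estimate D v ρ) ρ π i j := by
    rw [Finset.sum_congr rfl fun ρ h => by rw [← hupd ρ h], ← Finset.sum_image
      (f := fun ρ => gainUniform D v q (estimate D v ρ) ρ π i j) hinj]
    refine Finset.sum_le_sum_of_subset_of_nonneg (fun ρ h => ?_)
      fun ρ _ _ => (gain_nonneg hq _ ρ π i j).1
    obtain ⟨ρ', h', rfl⟩ := Finset.mem_image.1 h
    have := (Finset.mem_filter.1 h').2.1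
    simp only [hR, Finset.mem_filter, Finset.mem_univ, true_and]
    rwa [Function.update_of_ne hit.symm]
  have hL : ∑ ρ ∈ R', gainLater D v q (estimate D v ρ) ρ π j
      ≤ ∑ ρ ∈ R, gainLater D v q (estimate D v ρ) ρ π j :=
    Finset.sum_le_sum_of_subset_of_nonneg hsub fun ρ _ _ => (gain_nonneg hq _ ρ π i j).2.1
  have hF : ∑ ρ ∈ R', gainFinal D v q (estimate D v ρ) ρ π i j
      ≤ ∑ ρ ∈ R, gainFinal D v q (estimate D v ρ) ρ π i j :=
    Finset.sum_le_sum_of_subset_of_nonneg hsub fun ρ _ _ => (gain_nonneg hq _ ρ π i j).2.2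
  have hcard := card_role_le t i hit Role.stat Role.final
  -- The positive part is needed because `hcard` bounds the size of `R'` from below, which helps
  -- only with a nonnegative factor.
  have hlow : R'.card * max (q j - ε) 0 ≤ ∑ ρ ∈ R',
      (gainUniform D v q (estimate D v ρ) (Function.update ρ i Role.uniform) π i j +
        gainLater D v q (estimate D v ρ) ρ π j + gainFinal D v q (estimate D v ρ) ρ π i j) := by
    rw [← nsmul_eq_mul]
    refine Finset.card_nsmul_le_sum _ _ _ fun ρ h => ?_
    have hρ := (Finset.mem_filter.1 h).2
    have hn := gain_nonneg (D := D) (v := v) hq (estimate D v ρ) ρ π i j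
    have hn' := gain_nonneg (D := D) (v := v) hq (estimate D v ρ)
      (Function.update ρ i Role.uniform) π i j
    refine max_le ?_ (by linarith [hn.2.1, hn.2.2, hn'.1])
    rcases hε ρ hρ.1 with h1 | h1
    · have := le_gain_of_final (D := D) (v := v) hq hρ.2 π h1
      linarith
    · linarith [hn.2.1, hn.2.2, hn'.1]
  rw [Finset.sum_add_distrib, Finset.sum_add_distrib] at hlow ⊢
  have h1 : (q j - ε) * Fintype.card (Fin n → Role) ≤ 9 * (R'.card * max (q j - ε) 0) := by
    have h2 : (q j - ε) * (Fintype.card (Fin n → Role) : ℝ)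
        ≤ max (q j - ε) 0 * (Fintype.card (Fin n → Role) : ℝ) := by
      gcongr
      exact le_max_left _ _
    have h3 := mul_le_mul_of_nonneg_left hcard (le_max_right (q j - ε) 0)
    linarith
  linarith

end Gain

/-! ### Averaging over the remaining coins -/

section Coins

variable {n m : ℕ} {D : Fin n → SetValuation m → (Fin m → ℝ) → Finset (Fin m)}
  {v : Fin n → SetValuation m}

/-- Requiring exactly one zero coin is more than stopping at `k`, but it makes the events disjoint
and easy to count, at the cost of a constant factor. -/
theorem run_chunkLoop_of_halt {c : MechCoins n m} {w : ℝ} {k : Fin (numChunks m)}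
    (hk : ∀ k', c.halt k' = 0 ↔ k' = k) {ks : List (Fin (numChunks m))} (hks : k ∈ ks)
    (p : Fin m → ℝ) : (chunkLoop c w ks p).run D v =
      atPrices (lowPrice w k) (fpa D v (lowPrice w k) c.uniformBidders Finset.univ) := by
  induction ks generalizing p with
  | nil => simp at hks
  | cons a ks ih =>
    rw [run_chunkLoop_cons]
    split_ifs with h
    · rw [(hk a).1 h]
    · refine ih ((List.mem_cons.1 hks).resolve_left fun hka => h ?_) _
      rw [← hka, hk]

theorem run_chunkLoop_of_forall_ne {c : MechCoins n m} {w : ℝ} (hc : ∀ k, c.halt k ≠ 0)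
    (ks : List (Fin (numChunks m))) (p : Fin m → ℝ) : (chunkLoop c w ks p).run D v =
      atPrices (pricesAfter D v c.uniformBidders w c.bin ks p)
        (fpa D v (pricesAfter D v c.uniformBidders w c.bin ks p) c.finalBidders Finset.univ) := by
  induction ks generalizing p with
  | nil => exact run_chunkLoop_nil p
  | cons a ks ih =>
    rw [run_chunkLoop_cons, if_neg (hc a), ih]
    rfl

theorem welfare_nonneg (hv : ∀ i, IsValuation (v i)) (A : Bundles n m) : 0 ≤ welfare v A :=
  Finset.sum_nonneg fun i _ => (hv i).nonneg _

variable (D v) in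
/-- The welfare of the mechanism as a function of its coins. -/
noncomputable def coinWelfare (c : MechCoins n m) : ℝ := welfare v ((mechAlg c).run D v).alloc

theorem coinWelfare_nonneg (hv : ∀ i, IsValuation (v i)) (c : MechCoins n m) :
    0 ≤ coinWelfare D v c :=
  welfare_nonneg hv _

theorem card_mul_expectedWelfare :
    Fintype.card (MechCoins n m) * (mechanism D).expectedWelfare v
      = ∑ c, coinWelfare D v c := by
  have h : (mechanism D).expectedWelfare v = ∑ c : MechCoins n m,
      (PMF.uniformOfFintype (MechCoins n m) c).toReal * coinWelfare D v c := rfl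
  have h0 : (Fintype.card (MechCoins n m) : ℝ) ≠ 0 := by
    exact_mod_cast Fintype.card_ne_zero
  rw [h, Finset.mul_sum]
  refine Finset.sum_congr rfl fun c _ => ?_
  rw [PMF.uniformOfFintype_apply, ENNReal.toReal_inv, ENNReal.toReal_natCast, ← mul_assoc,
    mul_inv_cancel₀ h0, one_mul]

theorem expectedWelfare_nonneg (hv : ∀ i, IsValuation (v i)) :
    0 ≤ (mechanism D).expectedWelfare v :=
  Finset.sum_nonneg fun c _ => mul_nonneg ENNReal.toReal_nonneg (coinWelfare_nonneg hv c)

theorem sum_mechCoins (f : MechCoins n m → ℝ) :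
    ∑ c, f c = (∑ ρ, ∑ r, ∑ π, ∑ h, f ⟨true, ρ, r, π, h⟩) +
      ∑ ρ, ∑ r, ∑ π, ∑ h, f ⟨false, ρ, r, π, h⟩ := by
  rw [← MechCoins.equivProd.symm.sum_comp]
  simp only [Fintype.sum_prod_type, Fintype.sum_bool]
  rfl

theorem card_mechCoins : Fintype.card (MechCoins n m) = 2 * (Fintype.card (Fin n → Role) *
    (chunkSize m * (Fintype.card (Equiv.Perm (Fin n)) * numChunks m ^ numChunks m))) := by
  rw [Fintype.card_congr MechCoins.equivProd]
  simp only [Fintype.card_prod, Fintype.card_bool, Fintype.card_fin, Fintype.card_fun]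

theorem coinWelfare_grand (hv : ∀ i, IsValuation (v i)) {c : MechCoins n m}
    (hc : c.grand = true) (i : Fin n) : v i Finset.univ ≤ coinWelfare D v c := by
  rw [coinWelfare, run_mechAlg, if_pos hc]
  exact welfare_secondPriceOutcome hv i

theorem coinWelfare_of_halt {c : MechCoins n m} (hc : c.grand = false) {k : Fin (numChunks m)}
    (hk : ∀ k', c.halt k' = 0 ↔ k' = k) : coinWelfare D v c =
      chunkWelfare D v (uniformList c.role c.order) (estimate D v c.role) k := by
  rw [coinWelfare, run_mechAlg, if_neg (by simp [hc]),
    run_chunkLoop_of_halt hk (List.mem_finRange k)]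
  rfl

theorem coinWelfare_of_forall_ne {c : MechCoins n m} (hc : c.grand = false)
    (hk : ∀ k, c.halt k ≠ 0) : coinWelfare D v c =
      finalWelfare D v (uniformList c.role c.order) (finalList c.role) (estimate D v c.role)
        c.bin := by
  rw [coinWelfare, run_mechAlg, if_neg (by simp [hc]), run_chunkLoop_of_forall_ne hk]
  rfl

/-- This is $(1+1/t)^t\le e<4$. -/
theorem succ_pow_le_four_mul (t : ℕ) (ht : 1 ≤ t) : ((t : ℝ) + 1) ^ t ≤ 4 * (t : ℝ) ^ t := by
  have ht' : (0 : ℝ) < t := by exact_mod_cast ht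
  have h1 : (1 / (t : ℝ) + 1) ^ t ≤ Real.exp (1 / t) ^ t :=
    pow_le_pow_left₀ (by positivity) (Real.add_one_le_exp _) t
  rw [← Real.exp_nat_mul, mul_one_div_cancel ht'.ne'] at h1
  have h2 : ((t : ℝ) + 1) ^ t = (1 / (t : ℝ) + 1) ^ t * (t : ℝ) ^ t := by
    rw [← mul_pow]
    congr 1
    field_simp
    ring
  rw [h2]
  gcongr
  linarith [Real.exp_one_lt_d9]

/-! ### Counting the outcomes of the halting coins -/

section Halt

variable {a : ℕ} [NeZero a]

theorem card_halt_at (k : Fin a) :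
    ({h : Fin a → Fin a | ∀ k', h k' = 0 ↔ k' = k} : Finset (Fin a → Fin a)).card
      = (a - 1) ^ (a - 1) := by
  have : ({h : Fin a → Fin a | ∀ k', h k' = 0 ↔ k' = k} : Finset (Fin a → Fin a)) =
      Fintype.piFinset fun k' => if k' = k then {0} else Finset.univ.erase 0 := by
    ext h
    simp only [Finset.mem_filter, Finset.mem_univ, true_and, Fintype.mem_piFinset]
    refine forall_congr' fun k' => ?_
    by_cases hk : k' = k <;> simp [hk]
  rw [this, Fintype.card_piFinset, ← Finset.mul_prod_erase _ _ (Finset.mem_univ k),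
    Finset.prod_congr rfl fun k' hk' => by rw [if_neg (Finset.ne_of_mem_erase hk')]]
  simp

theorem card_halt_never :
    ({h : Fin a → Fin a | ∀ k, h k ≠ 0} : Finset (Fin a → Fin a)).card = (a - 1) ^ a := by
  have : ({h : Fin a → Fin a | ∀ k, h k ≠ 0} : Finset (Fin a → Fin a)) =
      Fintype.piFinset fun _ => Finset.univ.erase 0 := by
    ext h
    simp
  rw [this, Fintype.card_piFinset]
  simp

theorem le_card_halt_at (ha : 2 ≤ a) (k : Fin a) : (a : ℝ) ^ a / (4 * a) ≤
    ({h : Fin a → Fin a | ∀ k', h k' = 0 ↔ k' = k} : Finset (Fin a → Fin a)).card := by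
  obtain ⟨t, rfl⟩ : ∃ t, a = t + 1 := ⟨a - 1, by omega⟩
  rw [card_halt_at, div_le_iff₀ (by positivity)]
  have := succ_pow_le_four_mul t (by omega)
  rw [Nat.add_sub_cancel]
  push_cast
  rw [pow_succ]
  nlinarith [(Nat.cast_nonneg t : (0 : ℝ) ≤ t)]

/-- With a single chunk the loop always stops, so the final auction needs `2 ≤ a`. -/
theorem le_card_halt_never (ha : 2 ≤ a) : (a : ℝ) ^ a / 8 ≤
    ({h : Fin a → Fin a | ∀ k, h k ≠ 0} : Finset (Fin a → Fin a)).card := by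
  obtain ⟨t, rfl⟩ : ∃ t, a = t + 1 := ⟨a - 1, by omega⟩
  rw [card_halt_never, div_le_iff₀ (by positivity)]
  have h1 := succ_pow_le_four_mul t (by omega)
  have h2 : (1 : ℝ) ≤ t := by exact_mod_cast (by omega : 1 ≤ t)
  rw [Nat.add_sub_cancel]
  push_cast
  rw [pow_succ, pow_succ]
  have h3 : (0 : ℝ) ≤ (t : ℝ) ^ t := by positivity
  calc ((t : ℝ) + 1) ^ t * (t + 1) ≤ 4 * (t : ℝ) ^ t * (2 * t) := by
        gcongr
        linarith
    _ = _ := by ring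

end Halt

theorem le_sum_halt (hv : ∀ i, IsValuation (v i)) (ha : 2 ≤ numChunks m) (ρ : Fin n → Role)
    (r : Fin (chunkSize m)) (π : Equiv.Perm (Fin n)) :
    (numChunks m : ℝ) ^ numChunks m *
        ((∑ k, chunkWelfare D v (uniformList ρ π) (estimate D v ρ) k) / (4 * numChunks m) +
          finalWelfare D v (uniformList ρ π) (finalList ρ) (estimate D v ρ) r / 8)
      ≤ ∑ h, coinWelfare D v ⟨false, ρ, r, π, h⟩ := by
  set W := fun k => chunkWelfare D v (uniformList ρ π) (estimate D v ρ) k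
  set F := finalWelfare D v (uniformList ρ π) (finalList ρ) (estimate D v ρ) r
  have hW : ∀ k, 0 ≤ W k := fun k => welfare_nonneg hv _
  have hF : 0 ≤ F := welfare_nonneg hv _
  calc (numChunks m : ℝ) ^ numChunks m * ((∑ k, W k) / (4 * numChunks m) + F / 8)
      = (∑ k, (numChunks m : ℝ) ^ numChunks m / (4 * numChunks m) * W k)
          + (numChunks m : ℝ) ^ numChunks m / 8 * F := by
        rw [← Finset.mul_sum]
        ring
    _ ≤ (∑ k, ∑ h : Fin (numChunks m) → Fin (numChunks m),
          if ∀ k', h k' = 0 ↔ k' = k then W k else 0)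
          + ∑ h : Fin (numChunks m) → Fin (numChunks m), if ∀ k, h k ≠ 0 then F else 0 := by
        simp only [← Finset.sum_filter, Finset.sum_const, nsmul_eq_mul]
        refine add_le_add (Finset.sum_le_sum fun k _ => ?_) ?_
        · exact mul_le_mul_of_nonneg_right (le_card_halt_at ha k) (hW k)
        · exact mul_le_mul_of_nonneg_right (le_card_halt_never ha) hF
    _ = ∑ h : Fin (numChunks m) → Fin (numChunks m),
          ((∑ k, if ∀ k', h k' = 0 ↔ k' = k then W k else 0) + if ∀ k, h k ≠ 0 then F else 0) := by
        rw [Finset.sum_comm, Finset.sum_add_distrib]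
    _ ≤ ∑ h, coinWelfare D v ⟨false, ρ, r, π, h⟩ := by
        refine Finset.sum_le_sum fun h _ => ?_
        by_cases hn : ∀ k, h k ≠ 0
        · rw [if_pos hn, Finset.sum_eq_zero fun k _ => if_neg fun hk => hn k ((hk k).2 rfl),
            zero_add, coinWelfare_of_forall_ne rfl hn]
        · rw [if_neg hn, add_zero]
          by_cases he : ∃ k, ∀ k', h k' = 0 ↔ k' = k
          · obtain ⟨k, hk⟩ := he
            rw [Finset.sum_eq_single k
              (fun k' _ hne => if_neg fun hk' => hne ((hk k').1 ((hk' k').2 rfl))) (by simp),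
              if_pos hk, coinWelfare_of_halt rfl hk]
          -- Outcomes with several zero coins are discarded; their welfare is nonnegative.
          · rw [Finset.sum_eq_zero fun k _ => if_neg fun hk => he ⟨k, hk⟩]
            exact coinWelfare_nonneg hv _

theorem one_le_sqrt_logb (hm : 2 ≤ m) : 1 ≤ √(Real.logb 2 m) := by
  rw [Real.one_le_sqrt, Real.le_logb_iff_rpow_le one_lt_two (by positivity), Real.rpow_one]
  exact_mod_cast hm

theorem numChunks_le_two_mul (hm : 2 ≤ m) : (numChunks m : ℝ) ≤ 2 * √(Real.logb 2 m) := by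
  have h := one_le_sqrt_logb hm
  rw [numChunks, Nat.cast_max]
  refine max_le (by push_cast; linarith) ?_
  linarith [Nat.ceil_lt_add_one (Real.sqrt_nonneg (Real.logb 2 m))]

theorem chunkSize_le_five_mul (hm : 2 ≤ m) : (chunkSize m : ℝ) ≤ 5 * √(Real.logb 2 m) := by
  have h := one_le_sqrt_logb hm
  have h1 : √(Real.logb 2 m) ≤ numChunks m :=
    (Nat.le_ceil _).trans (by exact_mod_cast le_max_right _ _)
  have h0 : 0 ≤ Real.logb 2 m := Real.logb_nonneg one_lt_two (by exact_mod_cast by omega)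
  have h2 : 4 * Real.logb 2 m / numChunks m ≤ 4 * √(Real.logb 2 m) := by
    rw [div_le_iff₀ (by linarith)]
    nlinarith [Real.mul_self_sqrt h0]
  rw [chunkSize, Nat.cast_max]
  refine max_le (by push_cast; linarith) ?_
  linarith [Nat.ceil_lt_add_one (show 0 ≤ 4 * Real.logb 2 m / numChunks m by positivity)]

theorem two_le_numChunks (hm : 3 ≤ m) : 2 ≤ numChunks m := by
  refine le_trans ?_ (le_max_right _ _)
  rw [Nat.succ_le_iff, Nat.lt_ceil, Nat.cast_one, Real.lt_sqrt zero_le_one, one_pow,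
    Real.lt_logb_iff_rpow_lt one_lt_two (by positivity), Real.rpow_one]
  exact_mod_cast hm

end Coins

/-! ### The approximation ratio -/

section Approximation

variable {n m : ℕ} {D : Fin n → SetValuation m → (Fin m → ℝ) → Finset (Fin m)}
  {v : Fin n → SetValuation m}

/-- Each item has at most one owner in `O`, so the supporting prices of the bundles merge into one
vector; the sum over `i` has at most one nonzero term. -/
theorem exists_supporting_allocation (hv : ∀ i, IsXOS (v i)) {O : Bundles n m}
    (hO : IsAllocation O) : ∃ q : Fin m → ℝ, (∀ j, 0 ≤ q j) ∧
      (∀ i, v i (O i) = ∑ j ∈ O i, q j) ∧ ∀ i, ∀ S ⊆ O i, ∑ j ∈ S, q j ≤ v i S := by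
  choose Q hQ0 hQ1 hQ2 using fun i => (hv i).exists_supporting (O i)
  have h : ∀ i, ∀ j ∈ O i, (∑ i', if j ∈ O i' then Q i' j else 0) = Q i j := by
    intro i j hj
    rw [Finset.sum_eq_single i (fun i' _ hne => if_neg fun hj' =>
      Finset.disjoint_left.1 (hO i' i hne) hj' hj) (by simp), if_pos hj]
  refine ⟨fun j => ∑ i, if j ∈ O i then Q i j else 0, fun j => Finset.sum_nonneg fun i _ => ?_,
    fun i => ?_, fun i S hS => ?_⟩
  · split_ifs
    exacts [hQ0 i j, le_rfl]
  · rw [hQ1, Finset.sum_congr rfl (h i)]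
  · rw [Finset.sum_congr rfl fun j hj => h i j (hS hj)]
    exact hQ2 i S

theorem sum_card_mul_le {O : Bundles n m} (hO : IsAllocation O) (s : Finset (Fin n)) {a : ℝ}
    (ha : 0 ≤ a) : ∑ i ∈ s, ∑ _j ∈ O i, a ≤ m * a := by
  rw [← Finset.sum_biUnion fun i _ i' _ h => hO i i' h, Finset.sum_const, nsmul_eq_mul]
  gcongr
  exact (Finset.card_le_univ _).trans (by simp)

/-- The welfare is at most the number of items times the largest value of the grand bundle. -/
theorem welfare_le_card_mul (hv : ∀ i, IsXOS (v i)) {O : Bundles n m} (hO : IsAllocation O)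
    {t : Fin n} (ht : ∀ i, v i Finset.univ ≤ v t Finset.univ) :
    welfare v O ≤ m * v t Finset.univ := by
  have hv' := fun i => (hv i).isValuation
  refine le_trans ?_ (sum_card_mul_le hO Finset.univ ((hv' t).nonneg _))
  exact Finset.sum_le_sum fun i _ => ((hv i).le_sum_singleton _).trans <|
    Finset.sum_le_sum fun j _ => ((hv' i).2 _ _ (Finset.subset_univ _)).trans (ht i)

theorem le_sum_coinWelfare_grand (hv : ∀ i, IsValuation (v i)) (t : Fin n) :
    Fintype.card (Fin n → Role) * (chunkSize m * (Fintype.card (Equiv.Perm (Fin n)) *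
        (numChunks m : ℝ) ^ numChunks m)) * v t Finset.univ ≤
      ∑ ρ, ∑ r, ∑ π, ∑ h, coinWelfare D v ⟨true, ρ, r, π, h⟩ := by
  refine le_trans (le_of_eq ?_) (Finset.sum_le_sum fun ρ _ => Finset.sum_le_sum fun r _ =>
    Finset.sum_le_sum fun π _ => Finset.sum_le_sum fun h _ =>
      coinWelfare_grand (c := ⟨true, ρ, r, π, h⟩) hv rfl t)
  simp only [Finset.sum_const, Finset.card_univ, nsmul_eq_mul, Fintype.card_fun, Fintype.card_fin]
  push_cast
  ring

/-- Of the coins `r` and `h`, a fraction at least $1/(4\alpha)$ selects a given chunk auction and at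
least $1/(8L)$ the final auction with a given bin. As $\alpha\le 2s$ and $L\le 5s$ for
$s=\sqrt{\log_2 m}$, both losses are covered by $40s$; the factor 4 of `sum_gain_le` makes it
$160s$. -/
theorem sum_gain_le_sum_coinWelfare (hD : ∀ i, IsDemandRule (D i))
    (hv : ∀ i, IsValuation (v i)) (hm : 3 ≤ m) {O : Bundles n m} (hO : IsAllocation O)
    {q : Fin m → ℝ} (hq : ∀ i, ∀ S ⊆ O i, ∑ j ∈ S, q j ≤ v i S) (t : Fin n)
    (ρ : Fin n → Role) (π : Equiv.Perm (Fin n)) :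
    (chunkSize m * (numChunks m : ℝ) ^ numChunks m) *
        ∑ i ∈ Finset.univ.erase t, ∑ j ∈ O i, (gainUniform D v q (estimate D v ρ) ρ π i j +
          gainLater D v q (estimate D v ρ) ρ π j + gainFinal D v q (estimate D v ρ) ρ π i j) ≤
      160 * √(Real.logb 2 m) * ∑ r, ∑ h, coinWelfare D v ⟨false, ρ, r, π, h⟩ := by
  have h1 := Finset.sum_le_sum fun r (_ : r ∈ Finset.univ) =>
    le_sum_halt (D := D) hv (two_le_numChunks hm) ρ r π
  rw [← Finset.mul_sum, Finset.sum_add_distrib, Finset.sum_const, Finset.card_univ,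
    Fintype.card_fin, nsmul_eq_mul, ← Finset.sum_div] at h1
  have h2 := sum_gain_le hD hv hO hq t (estimate D v ρ) ρ π
  have hW : 0 ≤ ∑ k, chunkWelfare D v (uniformList ρ π) (estimate D v ρ) k :=
    Finset.sum_nonneg fun k _ => welfare_nonneg hv _
  have hF : 0 ≤ ∑ r, finalWelfare D v (uniformList ρ π) (finalList ρ) (estimate D v ρ) r :=
    Finset.sum_nonneg fun k _ => welfare_nonneg hv _
  have ha := numChunks_le_two_mul (by omega : 2 ≤ m)
  have hL := chunkSize_le_five_mul (by omega : 2 ≤ m)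
  have hs := one_le_sqrt_logb (by omega : 2 ≤ m)
  have ha0 : (0 : ℝ) < numChunks m := by exact_mod_cast Nat.pos_of_ne_zero (NeZero.ne _)
  set s := √(Real.logb 2 m)
  set W := ∑ k, chunkWelfare D v (uniformList ρ π) (estimate D v ρ) k
  set F := ∑ r, finalWelfare D v (uniformList ρ π) (finalList ρ) (estimate D v ρ) r
  set L : ℝ := (chunkSize m : ℝ)
  set a : ℝ := (numChunks m : ℝ)
  have hL0 : 0 ≤ L := Nat.cast_nonneg _
  have hH : 0 ≤ a ^ numChunks m := by positivity
  have h3 : L * W ≤ 40 * s * (L * (W / (4 * a))) := by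
    have : 40 * s * (L * (W / (4 * a))) = L * W * (10 * s / a) := by
      field_simp
      ring
    rw [this]
    refine le_mul_of_one_le_right (by positivity) ?_
    rw [one_le_div ha0]
    linarith
  have h4 : L * F ≤ 40 * s * (F / 8) := by nlinarith
  calc L * a ^ numChunks m * _ ≤ L * a ^ numChunks m * (4 * (W + F)) := by gcongr
    _ = 4 * a ^ numChunks m * (L * W + L * F) := by ring
    _ ≤ 4 * a ^ numChunks m * (40 * s * (L * (W / (4 * a))) + 40 * s * (F / 8)) := by gcongr
    _ = 160 * s * (a ^ numChunks m * (L * (W / (4 * a)) + F / 8)) := by ring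
    _ ≤ _ := by gcongr

/-- `le_sum_gain` is summed over items and orders, and the sums are exchanged to reach the bound for
fixed groups. The constant is 9 · 160. -/
theorem le_sum_coinWelfare_loop (hD : ∀ i, IsDemandRule (D i)) (hv : ∀ i, IsValuation (v i))
    (hm : 3 ≤ m) {O : Bundles n m} (hO : IsAllocation O) {q : Fin m → ℝ} (hq0 : ∀ j, 0 ≤ q j)
    (hq : ∀ i, ∀ S ⊆ O i, ∑ j ∈ S, q j ≤ v i S) (t : Fin n) {ε : ℝ} (hε0 : 0 ≤ ε)
    (hε : ∀ i, ∀ j ∈ O i, ∀ ρ : Fin n → Role, ρ t = Role.stat →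
      HasBin m (estimate D v ρ) (q j) ∨ q j ≤ ε) :
    Fintype.card (Fin n → Role) * (chunkSize m * (Fintype.card (Equiv.Perm (Fin n)) *
        (numChunks m : ℝ) ^ numChunks m)) *
          ∑ i ∈ Finset.univ.erase t, ∑ j ∈ O i, (q j - ε) ≤
      1440 * √(Real.logb 2 m) *
        ∑ ρ, ∑ r, ∑ π, ∑ h, coinWelfare D v ⟨false, ρ, r, π, h⟩ := by
  set H : ℝ := chunkSize m * (numChunks m : ℝ) ^ numChunks m with hH
  have hH0 : 0 ≤ H := by positivity
  calc Fintype.card (Fin n → Role) * (chunkSize m * (Fintype.card (Equiv.Perm (Fin n)) *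
        (numChunks m : ℝ) ^ numChunks m)) * ∑ i ∈ Finset.univ.erase t, ∑ j ∈ O i, (q j - ε)
      = H * ∑ π : Equiv.Perm (Fin n), ∑ i ∈ Finset.univ.erase t, ∑ j ∈ O i,
          (q j - ε) * Fintype.card (Fin n → Role) := by
        simp only [← Finset.sum_mul, Finset.sum_const, Finset.card_univ, nsmul_eq_mul]
        ring
    _ ≤ H * ∑ π : Equiv.Perm (Fin n), ∑ i ∈ Finset.univ.erase t, ∑ j ∈ O i,
          9 * ∑ ρ : Fin n → Role with ρ t = Role.stat,
            (gainUniform D v q (estimate D v ρ) ρ π i j +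
              gainLater D v q (estimate D v ρ) ρ π j +
                gainFinal D v q (estimate D v ρ) ρ π i j) := by
        refine mul_le_mul_of_nonneg_left (Finset.sum_le_sum fun π _ => Finset.sum_le_sum
          fun i hi => Finset.sum_le_sum fun j hj => ?_) hH0
        exact le_sum_gain hq0 (Finset.ne_of_mem_erase hi) π hε0 (hε i j hj)
    _ = 9 * ∑ ρ : Fin n → Role with ρ t = Role.stat, ∑ π : Equiv.Perm (Fin n),
          H * ∑ i ∈ Finset.univ.erase t, ∑ j ∈ O i,
            (gainUniform D v q (estimate D v ρ) ρ π i j +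
              gainLater D v q (estimate D v ρ) ρ π j +
                gainFinal D v q (estimate D v ρ) ρ π i j) := by
        simp only [← Finset.mul_sum]
        rw [mul_left_comm, Finset.sum_comm (s := {ρ : Fin n → Role | ρ t = Role.stat})]
        congr 2
        refine Finset.sum_congr rfl fun π _ => ?_
        rw [Finset.sum_comm (s := {ρ : Fin n → Role | ρ t = Role.stat})]
        exact Finset.sum_congr rfl fun i _ => Finset.sum_comm
    _ ≤ 9 * ∑ ρ : Fin n → Role with ρ t = Role.stat, ∑ π : Equiv.Perm (Fin n),
          160 * √(Real.logb 2 m) * ∑ r, ∑ h, coinWelfare D v ⟨false, ρ, r, π, h⟩ := by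
        refine mul_le_mul_of_nonneg_left (Finset.sum_le_sum fun ρ _ => Finset.sum_le_sum
          fun π _ => ?_) (by norm_num)
        exact sum_gain_le_sum_coinWelfare hD hv hm hO hq t ρ π
    _ ≤ 9 * ∑ ρ : Fin n → Role, ∑ π : Equiv.Perm (Fin n),
          160 * √(Real.logb 2 m) * ∑ r, ∑ h, coinWelfare D v ⟨false, ρ, r, π, h⟩ := by
        refine mul_le_mul_of_nonneg_left (Finset.sum_le_sum_of_subset_of_nonneg
          (Finset.subset_univ _) fun ρ _ _ => ?_) (by norm_num)
        have := fun c => coinWelfare_nonneg (D := D) (m := m) hv c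
        exact Finset.sum_nonneg fun π _ => mul_nonneg (by positivity)
          (Finset.sum_nonneg fun r _ => Finset.sum_nonneg fun h _ => this _)
    _ = _ := by
        simp only [← Finset.mul_sum]
        rw [Finset.sum_congr rfl fun ρ _ => Finset.sum_comm]
        ring

/-- With `t` in STAT the greedy estimate is at least every single-item value of `t`, so `m` times
the estimate covers `v t Finset.univ` and hence `q`. Below the first bin, `q` is under twice the
rounded estimate over `m ^ 2`, and rounding costs another factor 2. -/
theorem hasBin_or_le (hv : ∀ i, IsXOS (v i)) {O : Bundles n m}
    (hmax : ∀ A : Bundles n m, IsAllocation A → welfare v A ≤ welfare v O) (hm : 1 ≤ m)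
    {t : Fin n} (ht0 : 0 < v t Finset.univ) {ρ : Fin n → Role} (hρ : ρ t = Role.stat) {q : ℝ} (hq : q ≤ v t Finset.univ) :
    HasBin m (estimate D v ρ) q ∨ q ≤ 4 * welfare v O / (m : ℝ) ^ 2 := by
  have hv' := fun i => (hv i).isValuation
  obtain ⟨⟨A, hA, hAw⟩, hsingle⟩ := greedyWelfare_spec (D := D) hv' (statList ρ)
  change estimate D v ρ = _ at hAw
  change ∀ i ∈ statList ρ, ∀ j, v i {j} ≤ estimate D v ρ at hsingle
  have hm' : (0 : ℝ) < m := by exact_mod_cast hm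
  have h1 : v t Finset.univ ≤ m * estimate D v ρ := by
    refine ((hv t).le_sum_singleton _).trans ?_
    refine (Finset.sum_le_sum fun j _ => hsingle t (mem_statList.2 hρ) j).trans ?_
    simp
  have hw : 0 < estimate D v ρ := pos_of_mul_pos_right (ht0.trans_le h1) hm'.le
  by_cases h : binPrice m (estimate D v ρ) 1 ≤ q
  · exact Or.inl (exists_inBin hm hw h (hq.trans h1))
  · right
    refine (not_le.1 h).le.trans ?_
    unfold binPrice
    have h2 := roundUp_le hw
    have h3 : estimate D v ρ ≤ welfare v O := hAw ▸ hmax A hA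
    exact div_le_div_of_nonneg_right (by linarith) (by positivity)

theorem welfare_le_sqrt_logb_mul (hD : ∀ i, IsDemandRule (D i)) (hv : ∀ i, IsXOS (v i))
    (hm : 8 ≤ m) {O : Bundles n m} (hO : IsAllocation O)
    (hmax : ∀ A : Bundles n m, IsAllocation A → welfare v A ≤ welfare v O)
    {t : Fin n} (ht : ∀ i, v i Finset.univ ≤ v t Finset.univ) (ht0 : 0 < v t Finset.univ) :
    welfare v O ≤ 5760 * √(Real.logb 2 m) * (mechanism D).expectedWelfare v := by
  have hv' := fun i => (hv i).isValuation
  obtain ⟨q, hq0, hqO, hq⟩ := exists_supporting_allocation hv hO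
  have hOPT := welfare_nonneg hv' O
  have hm8 : (8 : ℝ) ≤ m := by exact_mod_cast hm
  set ε : ℝ := 4 * welfare v O / (m : ℝ) ^ 2 with hε
  have hε0 : 0 ≤ ε := by positivity
  have hloop := le_sum_coinWelfare_loop hD hv' (by omega) hO hq0 hq t hε0
    fun i j hj ρ hρ => hasBin_or_le (D := D) hv hmax (by omega) ht0 hρ <| by
      have := hq i {j} (by simpa using hj)
      rw [Finset.sum_singleton] at this
      exact this.trans (((hv' i).2 _ _ (Finset.subset_univ _)).trans (ht i))
  have hgrand := le_sum_coinWelfare_grand (D := D) hv' t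
  have hE := card_mul_expectedWelfare (D := D) (v := v)
  rw [sum_mechCoins, card_mechCoins] at hE
  push_cast at hE
  have hsum : welfare v O / 2 - v t Finset.univ
      ≤ ∑ i ∈ Finset.univ.erase t, ∑ j ∈ O i, (q j - ε) := by
    have h1 : ∑ i ∈ Finset.univ.erase t, ∑ _j ∈ O i, ε ≤ m * ε :=
      sum_card_mul_le hO _ hε0
    -- Here `m * ε` is four times the optimum over `m`; this is where `8 ≤ m` enters.
    have h2 : m * ε ≤ welfare v O / 2 := by
      rw [hε, sq, mul_div_assoc', div_le_iff₀ (by positivity)]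
      nlinarith [mul_nonneg hOPT (by linarith : (0 : ℝ) ≤ m), mul_nonneg
        (mul_nonneg hOPT (by linarith : (0 : ℝ) ≤ m)) (by linarith : (0 : ℝ) ≤ m - 8)]
    have h3 : welfare v O = v t (O t) + ∑ i ∈ Finset.univ.erase t, ∑ j ∈ O i, q j := by
      rw [welfare, ← Finset.add_sum_erase _ _ (Finset.mem_univ t),
        Finset.sum_congr rfl fun i _ => hqO i]
    have h4 := (hv' t).2 _ _ (Finset.subset_univ (O t))
    simp only [Finset.sum_sub_distrib]
    linarith
  have hs := one_le_sqrt_logb (by omega : 2 ≤ m)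
  set s := √(Real.logb 2 m)
  set N : ℝ := Fintype.card (Fin n → Role) * (chunkSize m * (Fintype.card (Equiv.Perm (Fin n)) *
    (numChunks m : ℝ) ^ numChunks m)) with hN
  have hN0 : 0 < N := by
    have h1 : (0 : ℝ) < Fintype.card (Fin n → Role) := by exact_mod_cast Fintype.card_pos
    have h2 : (0 : ℝ) < Fintype.card (Equiv.Perm (Fin n)) := by exact_mod_cast Fintype.card_pos
    have h3 : (0 : ℝ) < chunkSize m := by exact_mod_cast Nat.pos_of_ne_zero (NeZero.ne _)
    have h4 : (0 : ℝ) < numChunks m := by exact_mod_cast Nat.pos_of_ne_zero (NeZero.ne _)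
    positivity
  set E := (mechanism D).expectedWelfare v
  set B := ∑ ρ, ∑ r, ∑ π, ∑ h, coinWelfare D v ⟨false, ρ, r, π, h⟩
  have h5 : N * (welfare v O / 2 - v t Finset.univ) ≤ 1440 * s * B :=
    (mul_le_mul_of_nonneg_left hsum hN0.le).trans hloop
  have h6 : N * v t Finset.univ + B ≤ N * (2 * E) := by linarith
  -- Doubling `h5` gives `2880 * s * B` plus `2 * N * v t Finset.univ`. Both are absorbed into `2880
  -- * s` times the left side of `h6`, which yields 5760.
  have h7 : N * welfare v O ≤ N * (5760 * s * E) := by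
    have h8 : N * v t Finset.univ ≤ 1440 * s * (N * v t Finset.univ) :=
      le_mul_of_one_le_left (by positivity) (by linarith)
    nlinarith [mul_le_mul_of_nonneg_left h6 (by linarith : (0 : ℝ) ≤ 2880 * s)]
  exact le_of_mul_le_mul_left h7 hN0

theorem le_two_mul_expectedWelfare (hv : ∀ i, IsValuation (v i)) (t : Fin n) :
    v t Finset.univ ≤ 2 * (mechanism D).expectedWelfare v := by
  have hgrand := le_sum_coinWelfare_grand (D := D) hv t
  have hE := card_mul_expectedWelfare (D := D) (v := v)
  rw [sum_mechCoins, card_mechCoins] at hE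
  push_cast at hE
  have h2 : 0 ≤ ∑ ρ, ∑ r, ∑ π, ∑ h, coinWelfare D v ⟨false, ρ, r, π, h⟩ :=
    Finset.sum_nonneg fun ρ _ => Finset.sum_nonneg fun r _ => Finset.sum_nonneg fun π _ =>
      Finset.sum_nonneg fun h _ => coinWelfare_nonneg hv _
  have hN0 : (0 : ℝ) < Fintype.card (Fin n → Role) * (chunkSize m *
      (Fintype.card (Equiv.Perm (Fin n)) * (numChunks m : ℝ) ^ numChunks m)) := by
    have h1 : (0 : ℝ) < Fintype.card (Fin n → Role) := by exact_mod_cast Fintype.card_pos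
    have h2 : (0 : ℝ) < Fintype.card (Equiv.Perm (Fin n)) := by exact_mod_cast Fintype.card_pos
    have h3 : (0 : ℝ) < chunkSize m := by exact_mod_cast Nat.pos_of_ne_zero (NeZero.ne _)
    have h4 : (0 : ℝ) < numChunks m := by exact_mod_cast Nat.pos_of_ne_zero (NeZero.ne _)
    positivity
  exact le_of_mul_le_mul_left (by linarith) hN0

theorem exists_optimal_allocation (v : Fin n → SetValuation m) :
    ∃ O : Bundles n m, IsAllocation O ∧
      ∀ A : Bundles n m, IsAllocation A → welfare v A ≤ welfare v O := by
  obtain ⟨O, hO, hmax⟩ := Set.exists_max_image {A : Bundles n m | IsAllocation A} (welfare v)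
    (Set.toFinite _) ⟨fun _ => ∅, fun _ _ _ => Finset.disjoint_empty_left _⟩
  exact ⟨O, hO, hmax⟩

theorem welfare_le_sqrt_log_mul (hD : ∀ i, IsDemandRule (D i)) (hv : ∀ i, IsXOS (v i))
    (hm : 2 ≤ m) {O : Bundles n m} (hO : IsAllocation O) :
    welfare v O ≤ 10000 * √(Real.log m) * (mechanism D).expectedWelfare v := by
  have hv' := fun i => (hv i).isValuation
  have hE := expectedWelfare_nonneg (D := D) hv'
  have hlog2 := Real.log_two_gt_d9
  have hlog : Real.log 2 ≤ Real.log m :=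
    Real.log_le_log two_pos (by exact_mod_cast hm)
  have hrhs : 0 ≤ 10000 * √(Real.log m) * (mechanism D).expectedWelfare v := by positivity
  rcases isEmpty_or_nonempty (Fin n) with _ | _
  · simpa [welfare] using hrhs
  obtain ⟨t, ht⟩ := Finite.exists_max fun i => v i Finset.univ
  rcases ((hv' t).nonneg Finset.univ).eq_or_lt with ht0 | ht0
  · have := welfare_le_card_mul hv hO ht
    rw [← ht0, mul_zero] at this
    exact this.trans hrhs
  obtain ⟨O', hO', hmax⟩ := exists_optimal_allocation v
  by_cases hm8 : 8 ≤ m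
  · refine (hmax O hO).trans ((welfare_le_sqrt_logb_mul hD hv hm8 hO' hmax ht ht0).trans ?_)
    -- The change of base costs `1 / log 2 ≤ 9 / 4` under the root, and 5760 · 3/2 stays below
    -- 10000.
    have hs : √(Real.logb 2 m) ≤ 3 / 2 * √(Real.log m) := by
      rw [Real.sqrt_le_left (by positivity), mul_pow, Real.sq_sqrt (by linarith), Real.logb,
        div_le_iff₀ (by linarith)]
      nlinarith
    gcongr ?_ * _
    linarith [Real.sqrt_nonneg (Real.log m)]
  -- For few items the second price auction alone suffices: the welfare is at most `7 * v t
  -- Finset.univ`, hence at most 14 times the expected welfare.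
  · have hm7 : (m : ℝ) ≤ 7 := by exact_mod_cast (by omega : m ≤ 7)
    have hs : 1 / 2 ≤ √(Real.log m) := Real.le_sqrt_of_sq_le (by linarith)
    have h1 := welfare_le_card_mul hv hO ht
    have h2 := le_two_mul_expectedWelfare (D := D) hv' t
    nlinarith

end Approximation

end CombAuction

theorem mainTheorem1 :
    (∃ C : ℝ, 0 < C ∧ ∃ a d : ℕ, ∀ n m : ℕ,
      (∀ c : MechCoins n m, (mechAlg c).AsksAtMost (a * (n + m) ^ d + a)) ∧
      ∀ D : Fin n → SetValuation m → (Fin m → ℝ) → Finset (Fin m), (∀ i, IsDemandRule (D i)) →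
        (mechanism D).UniversallyTruthful {v | IsXOS v} ∧
        (2 ≤ m → ∀ v : Fin n → SetValuation m, (∀ i, IsXOS (v i)) →
          ∀ O : Bundles n m, IsAllocation O →
            welfare v O ≤ C * √(Real.log m) * (mechanism D).expectedWelfare v)) ∧
    ∀ (m : ℕ) (v : SetValuation m), IsValuation v → IsSubmodular v → IsXOS v :=
  ⟨⟨10000, by norm_num, 10, 2, fun _ _ => ⟨asksAtMost_mechAlg, fun _ hD =>
    ⟨mechanism_universallyTruthful hD, fun hm _ hv _ hO => welfare_le_sqrt_log_mul hD hv hm hO⟩⟩⟩,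
    fun _ _ hv h => h.isXOS hv⟩
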